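/- Let $X$ be a compact polyhedral tropical space with a finite unimodular triangulation: every mobile cell (closed cell not contained in the locus at infinity) lies in a chart to some $\mathbb T^N=[-\infty,\infty)^N$, in which it is (the closure of) the product of a unimodular simplex and a unimodular cone spanned by divisorial vectors $-e_i$; overlap maps are integral affine, mobile faces of cells are cells, two cells that meet do so in a common mobile face, and $X$ is pure-dimensional and balanced in codimension one. (In particular this covers every unimodularly triangulated smooth tropical limit of a projective degeneration.) **Barycentric chains.** The $q$-simplices of the first barycentric subdivision are the flags $\sigma=(F_0<\dots<F_q)$ of mobile cells, with vertices ordered as written. The barycenter of a finite cell is any interior point; the barycenter of an infinite cell is an interior point of its most sedentary face. $C^{bar}_q(X;\mathcal F_p\otimes\mathbb R)$ is the space of $q$-chains with coefficients in $\mathcal F_p(\sigma)\otimes\mathbb R$, where $\mathcal F_p(\sigma)$ is spanned by the products of $p$ vectors tangent to a single cell $G\ge F_q$, projected along the divisorial directions of $F_0$. **Eigenwave.** For each cell $F$ choose a nearby mobile point $y_F$, i.e. a point of the interior of $F$ that projects to the barycenter of $F$ along the divisorial directions of $F$. The eigenwave $\phi\in C^1(X;\mathcal W_1)/B^1_{div}(X;\mathcal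 W_1)$ is the class of the cochain $(E<F)\mapsto y_F-y_E$, modulo coboundaries of $0$-cochains with values in the divisorial subspaces. The cap product with a $1$-cochain $\psi$ is $\psi\cap\sum\beta_\sigma\sigma=\sum(\psi(\sigma_{01})\wedge\beta_\sigma)\,\sigma_{1\dots q}$, where the coefficient is pushed to $\sigma_{1\dots q}$ by projection along divisorial directions. **Propellers.** Let $\Delta$ be an oriented finite mobile $k$-simplex. A propeller $c\in H_{2l}(\Delta)$ is a formal rational combination $c=\sum_{\bar q}\rho_{\bar q}\{\Delta\bar q\}$ of the mobile cells $\{\Delta\bar q\}\supseteq\Delta$ of dimension $k+l$, where $\bar q$ is the set of the $l$ vertices and divisorial vectors of the cell that do not belong to $\Delta$, which is balanced along every $(k+l-1)$-dimensional mobile cell containing $\Delta$. **Konstruktor chains.** For $0\le r\le k$ let $$c[-r]=\sum_{\bar q}\ \sum_{\Delta'\prec\Delta,\ \dim\Delta'=r}\bigl(\rho_{\bar q}\operatorname{Vol}_{\Delta'\bar q}\bigr)\,\hat\Delta'_{\Delta\bar q}\ \in\ C^{bar}_{k+l-r}(X;\mathcal F_{l+r}\otimes\mathbb R),$$ where $\hat\Delta'_{\Delta\bar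 q}$ is the dual cell of $\Delta'$ in $\{\Delta\bar q\}$, i.e. the sum of all flags $\Delta'=F_0<F_1<\dots<F_m=\{\Delta\bar q\}$ with $m=k+l-r$, with the following signs. Let $\operatorname{Vol}_\Delta$ be the volume element of the oriented simplex $\Delta$, choose integral volume elements $\operatorname{Vol}_{\Delta'}$ of $\Delta'$ and $\operatorname{Vol}_{\bar q}$ (the product of the elements of $\bar q$ in some order, a vertex $q$ standing for the vector from a vertex of $\Delta'$ to $q$), and put $\operatorname{Vol}_{\Delta'\bar q}=\operatorname{Vol}_{\Delta'}\wedge\operatorname{Vol}_{\bar q}$. If $u_i$ is the vector from a vertex of $\Delta'$ to the vertex of $F_i$ not in $F_{i-1}$, or the divisorial vector of $F_i$ not in $F_{i-1}$, then the flag has the sign $\varepsilon\in\{1,-1\}$ given by $u_m\wedge\dots\wedge u_1\wedge\operatorname{Vol}_{\Delta'}=\varepsilon\operatorname{Vol}_\Delta\wedge\operatorname{Vol}_{\bar q}$. The product $\operatorname{Vol}_{\Delta'\bar q}\,\hat\Delta'_{\Delta\bar q}$ does not depend on the choices. Put $c[-k-1]=0$. **Proposition.** For every propeller $c\in H_{2l}(\Delta)$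 and every $0\le r\le k$ with $k+l-r\ge1$, $$\phi\cap(c[-r])=c[-r-1]$$ in $C^{bar}_{k+l-r-1}(X;\mathcal F_{l+r+1}\otimes\mathbb R)$. That is, $\psi\cap(c[-r])=c[-r-1]$ for every choice of barycenters and for every cochain $\psi$ representing $\phi$. -/

import Mathlib

open scoped BigOperators Classical

noncomputable section

namespace Tropical11

/-! ### Tropical affine space -/

/-- The tropical numbers `[-∞, ∞)`, with the subspace topology of the extended reals. -/
abbrev TropNum : Type := Set.Iio (⊤ : EReal)

/-- Tropical affine space `𝕋^N = [-∞, ∞)^N`, with the product topology. -/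
abbrev TropAffine (N : ℕ) : Type := Fin N → TropNum

/-- A point is mobile (has sedentarity zero) if none of its coordinates is `-∞`. -/
def IsMobile {N : ℕ} (x : TropAffine N) : Prop := ∀ i, (x i : EReal) ≠ ⊥

/-- The real coordinates of a (mobile) point; coordinates equal to `-∞` are read as `0`, and
this value is only used at mobile points or for finite coordinates. -/
def realCoord {N : ℕ} (x : TropAffine N) : Fin N → ℝ := fun i => (x i : EReal).toReal

/-- The integral affine map `x ↦ A x + c`, extended by continuity, is defined at `x` and takes
the value `y` there. (It extends to `x` iff every coordinate of `x` equal to `-∞` enters with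
nonnegative coefficients only; in `EReal` one has `0 * ⊥ = 0`.) -/
def IsAffineValue {M N : ℕ} (A : Matrix (Fin M) (Fin N) ℤ) (c : Fin M → ℝ)
    (x : TropAffine N) (y : TropAffine M) : Prop :=
  (∀ i j, (x j : EReal) = ⊥ → 0 ≤ A i j) ∧
    ∀ i, (y i : EReal) = (∑ j, (((A i j : ℤ) : ℝ) : EReal) * (x j : EReal)) + ((c i : ℝ) : EReal)

/-- The closure in `𝕋^N` of the Minkowski sum of the simplex with vertex set `V` and the cone
spanned by the divisorial vectors `-e_i`, `i ∈ I`. -/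
def simplexCone {N : ℕ} (V : Finset (Fin N → ℝ)) (I : Finset (Fin N)) : Set (TropAffine N) :=
  {x | ∃ z ∈ convexHull ℝ (V : Set (Fin N → ℝ)),
    ∀ i, if i ∈ I then (x i : EReal) ≤ (z i : EReal) else (x i : EReal) = (z i : EReal)}

/-- `V` is the vertex set of a simplex and the product of this simplex with the cone on the
`-e_i`, `i ∈ I`, is unimodular: for every `v₀ ∈ V` the vectors `v - v₀` (`v ∈ V`, `v ≠ v₀`) and
`-e_i` (`i ∈ I`) are distinct members of a basis of the lattice `ℤ^N`. -/
def IsUnimodular {N : ℕ} (V : Finset (Fin N → ℝ)) (I : Finset (Fin N)) : Prop :=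
  V.Nonempty ∧ ∀ v₀ ∈ V, ∃ (b : Module.Basis (Fin N) ℤ (Fin N → ℤ))
    (j : {v // v ∈ V ∧ v ≠ v₀} ⊕ {i // i ∈ I} → Fin N), Function.Injective j ∧
      (∀ v, v.1 - v₀ = fun n => ((b (j (Sum.inl v)) n : ℤ) : ℝ)) ∧
      (∀ i, b (j (Sum.inr i)) = -Pi.single i.1 1)

/-- The set of coordinates (in the chart `f`) that take the value `-∞` on `s`: the index set of
the divisorial directions of the cell `s`. -/
def divIndex {X : Type*} {N : ℕ} (f : X → TropAffine N) (s : Set X) : Finset (Fin N) :=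
  Finset.univ.filter fun i => ∃ x ∈ s, (f x i : EReal) = ⊥

/-- The vertices in `P` that lie on `s`. -/
def vertsIn {X : Type*} (P : Finset X) (s : Set X) : Finset X := P.filter (· ∈ s)

/-- The mobile face of the cell `s` with vertices `V` and divisorial directions `I`, seen in the
chart `f`. -/
def cellFace {X : Type*} {N : ℕ} (f : X → TropAffine N) (s : Set X)
    (V : Finset X) (I : Finset (Fin N)) : Set X :=
  {x ∈ s | f x ∈ simplexCone (V.image fun v => realCoord (f v)) I}

/-! ### Unimodularly triangulated complexes with integral affine charts -/

/-- A space with an atlas of charts to tropical affine spaces with integral affine overlap maps,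
and a finite unimodular triangulation. The members of `cells` are the closed mobile cells. -/
structure UnimodularComplex (X : Type*) [TopologicalSpace X] where
  /-- the number of charts -/
  numCharts : ℕ
  /-- the dimension of the target of a chart -/
  N : Fin numCharts → ℕ
  /-- the domain of a chart -/
  U : Fin numCharts → Set X
  isOpen_U : ∀ a, IsOpen (U a)
  /-- the charts, relevant on `U a` only -/
  chart : ∀ a, X → TropAffine (N a)
  isEmbedding : ∀ a, Topology.IsEmbedding ((U a).domRestrict (chart a))
  /-- the linear part of the overlap map from the chart `a` to the chart `b` -/
  trans : ∀ a b, Matrix (Fin (N b)) (Fin (N a)) ℤ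
  /-- the translation part of the overlap map -/
  shift : ∀ (_ b : Fin numCharts), Fin (N b) → ℝ
  trans_spec : ∀ a b, ∀ x ∈ U a ∩ U b, IsAffineValue (trans a b) (shift a b) (chart a x) (chart b x)
  /-- the mobile vertices -/
  vertices : Finset X
  /-- the mobile cells -/
  cells : Finset (Set X)
  isClosed_cell : ∀ s ∈ cells, IsClosed s
  /-- every point lies on a cell -/
  cover : ∀ x : X, ∃ s ∈ cells, x ∈ s
  /-- a chart around a given cell -/
  chartAt : {s // s ∈ cells} → Fin numCharts
  subset_chartAt : ∀ s, s.1 ⊆ U (chartAt s)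
  vertsIn_nonempty : ∀ s ∈ cells, (vertsIn vertices s).Nonempty
  isMobile_vertex : ∀ s ∈ cells, ∀ a, s ⊆ U a → ∀ v ∈ vertsIn vertices s, IsMobile (chart a v)
  /-- in a chart a cell is the product of a unimodular simplex and a unimodular cone spanned by
  divisorial vectors -/
  isUnimodular : ∀ s ∈ cells, ∀ a, s ⊆ U a →
    IsUnimodular ((vertsIn vertices s).image fun v => realCoord (chart a v)) (divIndex (chart a) s)
  image_cell : ∀ s ∈ cells, ∀ a, s ⊆ U a →
    chart a '' s =
      simplexCone ((vertsIn vertices s).image fun v => realCoord (chart a v)) (divIndex (chart a) s)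
  /-- mobile faces of cells are cells -/
  face_mem : ∀ s ∈ cells, ∀ a, s ⊆ U a → ∀ V ⊆ vertsIn vertices s, V.Nonempty →
    ∀ I ⊆ divIndex (chart a) s, cellFace (chart a) s V I ∈ cells
  /-- two cells that meet do so in a common mobile face -/
  inter_face : ∀ s ∈ cells, ∀ t ∈ cells, (s ∩ t).Nonempty → ∀ a, s ⊆ U a →
    ∃ V ⊆ vertsIn vertices s, V.Nonempty ∧ ∃ I ⊆ divIndex (chart a) s,
      s ∩ t = cellFace (chart a) s V I

namespace UnimodularComplex

variable {X : Type*} [TopologicalSpace X] (T : UnimodularComplex X)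

/-- The mobile cells, partially ordered by inclusion (which is the relation of being a face). -/
abbrev Cell : Type _ := {s : Set X // s ∈ T.cells}

/-- Real coordinates of a point in the chart `a`. -/
def pt (a : Fin T.numCharts) (x : X) : Fin (T.N a) → ℝ := realCoord (T.chart a x)

/-- The mobile vertices of a cell. -/
def verts (F : T.Cell) : Finset X := vertsIn T.vertices F.1

/-- The (indices of the) divisorial directions of a cell in the chart `a`. -/
def dirs (a : Fin T.numCharts) (F : T.Cell) : Finset (Fin (T.N a)) := divIndex (T.chart a) F.1

/-- The dimension of a cell: that of its simplex plus that of its cone. -/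
def cellDim (F : T.Cell) : ℕ := ((T.verts F).card - 1) + (T.dirs (T.chartAt F) F).card

/-- A cell is finite if all its points are mobile. -/
def IsFinite (F : T.Cell) : Prop := ∀ a, ∀ x ∈ F.1, x ∈ T.U a → IsMobile (T.chart a x)

/-- The tangent space (in the chart `a`) of the mobile cell `F`. -/
def lin (a : Fin T.numCharts) (F : T.Cell) : Submodule ℝ (Fin (T.N a) → ℝ) :=
  Submodule.span ℝ {w | ∃ x ∈ F.1 ∩ T.U a, ∃ x' ∈ F.1 ∩ T.U a,
    IsMobile (T.chart a x) ∧ IsMobile (T.chart a x') ∧ w = T.pt a x - T.pt a x'}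

/-- The divisorial subspace (in the chart `a`) of the cell `F`. -/
def divSpace (a : Fin T.numCharts) (F : T.Cell) : Submodule ℝ (Fin (T.N a) → ℝ) :=
  Submodule.span ℝ {w | ∃ i ∈ T.dirs a F, w = -Pi.single i 1}

/-- The differential of an overlap map. -/
def transLin (a b : Fin T.numCharts) : (Fin (T.N a) → ℝ) →ₗ[ℝ] (Fin (T.N b) → ℝ) :=
  Matrix.toLin' ((T.trans a b).map (Int.cast : ℤ → ℝ))

/-- The generators of a cell in the chart `a`: its vertices and its divisorial directions. -/
def gens (a : Fin T.numCharts) (F : T.Cell) : Finset (X ⊕ Fin (T.N a)) :=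
  (T.verts F).disjSum (T.dirs a F)

/-- The vector from the vertex `p` to a generator: `v - p` for a vertex `v`, and the divisorial
vector `-e_i` for a divisorial direction `i`. -/
def vec (a : Fin T.numCharts) (p : X) : X ⊕ Fin (T.N a) → (Fin (T.N a) → ℝ)
  | Sum.inl v => T.pt a v - T.pt a p
  | Sum.inr i => -Pi.single i 1

/-- A chosen vertex of a cell. -/
def base (F : T.Cell) : X := (T.vertsIn_nonempty F.1 F.2).choose

lemma base_mem (F : T.Cell) : T.base F ∈ T.verts F := (T.vertsIn_nonempty F.1 F.2).choose_spec

/-- The outward primitive vector of `F` along its facet `E`, in the chart around `E` and modulo the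
tangent space of `E` (the difference of the generators consists of one element). -/
def outward (E F : T.Cell) : Fin (T.N (T.chartAt E)) → ℝ :=
  T.transLin (T.chartAt F) (T.chartAt E)
    (∑ g ∈ T.gens (T.chartAt F) F \ T.gens (T.chartAt F) E, T.vec (T.chartAt F) (T.base E) g)

end UnimodularComplex

/-- A (compact, polyhedral) tropical space with a unimodular triangulation: pure dimensional, and
balanced along each mobile cell of codimension one. -/
structure UnimodularTropicalSpace (X : Type*) [TopologicalSpace X] extends
    UnimodularComplex X where
  /-- the dimension of the space -/
  dim : ℕ
  pure_dim : ∀ F : toUnimodularComplex.Cell, ∃ G : toUnimodularComplex.Cell,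
    F ≤ G ∧ toUnimodularComplex.cellDim G = dim
  balanced : ∀ E : toUnimodularComplex.Cell, toUnimodularComplex.cellDim E + 1 = dim →
    ∑ F : toUnimodularComplex.Cell with E ≤ F ∧ toUnimodularComplex.cellDim F = dim,
        toUnimodularComplex.outward E F ∈
      toUnimodularComplex.lin (toUnimodularComplex.chartAt E) E

namespace UnimodularComplex

variable {X : Type*} [TopologicalSpace X] (T : UnimodularComplex X)

/-! ### Propellers -/

/-- `Link_l(Δ)`: the cells `{Δ q̄}` that contain `Δ` and whose dimension is larger by `l`. -/
abbrev Link (Δ : T.Cell) (l : ℕ) : Type _ :=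
  {F : T.Cell // Δ ≤ F ∧ T.cellDim F = T.cellDim Δ + l}

/-- The rational vector space of propellers: formal rational combinations of the cells in
`Link_l(Δ)`, balanced along each cell of `Link_{l-1}(Δ)`. -/
def propellers (Δ : T.Cell) (l : ℕ) : Submodule ℚ (T.Link Δ l → ℚ) where
  carrier := {ρ | ∀ E : T.Cell, Δ ≤ E → T.cellDim E + 1 = T.cellDim Δ + l →
    ∑ F : T.Link Δ l with E ≤ F.1, ((ρ F : ℚ) : ℝ) • T.outward E F.1 ∈ T.lin (T.chartAt E) E}
  zero_mem' := by
    intro E _ _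
    simp
  add_mem' := by
    intro x y hx hy E h1 h2
    have := Submodule.add_mem _ (hx E h1 h2) (hy E h1 h2)
    rw [← Finset.sum_add_distrib] at this
    simpa [add_smul] using this
  smul_mem' := by
    intro t x hx E h1 h2
    have := Submodule.smul_mem _ ((t : ℚ) : ℝ) (hx E h1 h2)
    rw [Finset.smul_sum] at this
    simpa [mul_smul] using this

/-! ### Barycentric chains with coefficients in `ℱ_p ⊗ ℝ` -/

/-- The `q`-simplices of the first barycentric subdivision: strictly increasing flags
`F₀ < ⋯ < F_q` of mobile cells. The vertices are the barycenters of the `F_i` (all faces of a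
family share their barycenter), ordered by the dimension of the cells. -/
abbrev BarSimplex (q : ℕ) : Type _ := Fin (q + 1) ↪o T.Cell

instance (q : ℕ) : Fintype (T.BarSimplex q) := Fintype.ofFinite _

/-- The exterior algebra of the ambient space of the chart `a`. -/
abbrev Ext (a : Fin T.numCharts) : Type := ExteriorAlgebra ℝ (Fin (T.N a) → ℝ)

/-- The projection `ℝ^N → ℝ^(N - I)` along the coordinate directions in `I`, the target being
regarded as a coordinate subspace of `ℝ^N`. -/
def killDirs {N : ℕ} (I : Finset (Fin N)) : (Fin N → ℝ) →ₗ[ℝ] (Fin N → ℝ) :=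
  LinearMap.pi fun i => if i ∈ I then 0 else LinearMap.proj i

/-- The group `ℱ_p ⊗ ℝ` at the interior points of a barycentric simplex with first cell `E` and last
cell `F`. These points lie in the interior of the face of `F` whose sedentarity is given by the
divisorial directions of `E`, so `ℱ_p` is spanned by the products of `p` vectors that come from a
single cell `G ≥ F`, projected along the divisorial directions of `E`. -/
def coeffs (p : ℕ) (E F : T.Cell) : Submodule ℝ (T.Ext (T.chartAt F)) :=
  Submodule.span ℝ {w | ∃ G : T.Cell, F ≤ G ∧ ∃ v : Fin p → (Fin (T.N (T.chartAt F)) → ℝ),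
    (∀ j, v j ∈ T.lin (T.chartAt F) G) ∧
    w = ExteriorAlgebra.ιMulti ℝ p (fun j => killDirs (T.dirs (T.chartAt F) E) (v j))}

/-- The group `C^bar_q(X; ℱ_p ⊗ ℝ)` of barycentric `q`-chains. -/
abbrev Chain (p q : ℕ) : Type _ :=
  ∀ σ : T.BarSimplex q, T.coeffs p (σ 0) (σ (Fin.last q))

/-- The face `σ_{1…q+1}` of a simplex `σ = σ_{0…q+1}`. -/
def tail {q : ℕ} (σ : T.BarSimplex (q + 1)) : T.BarSimplex q :=
  (Fin.succOrderEmb (q + 1)).trans σ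

lemma killDirs_killDirs {N : ℕ} {I J : Finset (Fin N)} (h : I ⊆ J) (v : Fin N → ℝ) :
    killDirs J (killDirs I v) = killDirs J v := by
  ext i
  by_cases hJ : i ∈ J
  · simp [killDirs, hJ]
  · have hI : i ∉ I := fun hI => hJ (h hI)
    simp [killDirs, hJ, hI]

lemma lin_mono (a : Fin T.numCharts) {F G : T.Cell} (h : F ≤ G) : T.lin a F ≤ T.lin a G := by
  apply Submodule.span_mono
  rintro w ⟨x, hx, x', hx', h1, h2, rfl⟩
  exact ⟨x, ⟨h hx.1, hx.2⟩, x', ⟨h hx'.1, hx'.2⟩, h1, h2, rfl⟩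

lemma dirs_mono (a : Fin T.numCharts) {F G : T.Cell} (h : F ≤ G) : T.dirs a F ⊆ T.dirs a G := by
  intro i hi
  simp only [dirs, divIndex, Finset.mem_filter, Finset.mem_univ, true_and] at hi ⊢
  obtain ⟨x, hx, hxi⟩ := hi
  exact ⟨x, h hx, hxi⟩

/-- The coefficient map of the cap product: wedge on the left with (the projection of) a vector
`w`, then push forward along the divisorial directions of `E'`. -/
def wedgePush {E E' F : T.Cell} (p : ℕ) (hE : E ≤ E') (hF : E' ≤ F)
    (w : T.lin (T.chartAt F) E') : T.coeffs p E F →ₗ[ℝ] T.coeffs (p + 1) E' F :=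
  LinearMap.restrict
    ((ExteriorAlgebra.map (killDirs (T.dirs (T.chartAt F) E'))).toLinearMap ∘ₗ
      LinearMap.mulLeft ℝ (ExteriorAlgebra.ι ℝ (killDirs (T.dirs (T.chartAt F) E) w.1)))
    (by
      intro x hx
      induction hx using Submodule.span_induction with
      | mem x h =>
        obtain ⟨G, hG, v, hv, rfl⟩ := h
        apply Submodule.subset_span
        refine ⟨G, hG, Fin.cons w.1 v, ?_, ?_⟩
        · intro j
          refine Fin.cases ?_ (fun j => ?_) j
          · exact T.lin_mono _ (hF.trans hG) w.2
          · simpa using hv j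
        · simp only [LinearMap.comp_apply, LinearMap.mulLeft_apply, AlgHom.toLinearMap_apply,
            map_mul, ExteriorAlgebra.map_apply_ι, ExteriorAlgebra.ιMulti_apply,
            killDirs_killDirs (T.dirs_mono _ hE), map_list_prod, List.map_ofFn, List.ofFn_succ,
            List.prod_cons, Fin.cons_zero, Fin.cons_succ, Function.comp_def]
      | zero => simp
      | add x y _ _ hx hy => rw [map_add]; exact Submodule.add_mem _ hx hy
      | smul t x _ hx => rw [map_smul]; exact Submodule.smul_mem _ t hx)

/-! ### The eigenwave and the cap product -/

/-- A wave 1-cochain on the barycentric subdivision. The value on the 1-simplex `E < F` lies in the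
tangent space of the cell `F` (a subspace of the wave tangent space), it is given in each chart
around `F`, and the values in different charts correspond under the overlap differentials. -/
structure WaveCochain where
  /-- the value on the simplex `E < F` in the chart `a` -/
  val : ∀ (E F : T.Cell), E < F → ∀ a, F.1 ⊆ T.U a → Fin (T.N a) → ℝ
  mem : ∀ E F h a ha, val E F h a ha ∈ T.lin a F
  compat : ∀ E F h a ha b hb, T.transLin a b (val E F h a ha) = val E F h b hb

/-- A choice of barycenters: the barycenter of `F` is an interior point of the most sedentary
face of `F`. For a finite cell this is an arbitrary interior point. -/
def IsBarycenter (b : T.Cell → X) : Prop :=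
  ∀ F : T.Cell, b F ∈ F.1 ∧ (∀ E : T.Cell, E < F → b F ∉ E.1) ∧
    ∀ i ∈ T.dirs (T.chartAt F) F, (T.chart (T.chartAt F) (b F) i : EReal) = ⊥

/-- `y F` is a nearby mobile point of the barycenter `b F`: it lies in the interior of the mobile
cell `F` and is mapped to `b F` by the projection along the divisorial directions of `F`. -/
def IsNearby (b y : T.Cell → X) : Prop :=
  ∀ F : T.Cell, y F ∈ F.1 ∧ (∀ E : T.Cell, E < F → y F ∉ E.1) ∧
    IsMobile (T.chart (T.chartAt F) (y F)) ∧
    ∀ i ∉ T.dirs (T.chartAt F) F,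
      T.chart (T.chartAt F) (y F) i = T.chart (T.chartAt F) (b F) i

/-- `f` is a 0-cochain with values in the divisorial subspaces (the value at the barycenter of `F`
being given in each chart around `F`). -/
def IsDivCochain (f : ∀ (F : T.Cell) (a : Fin T.numCharts), F.1 ⊆ T.U a → Fin (T.N a) → ℝ) :
    Prop :=
  (∀ F a ha, f F a ha ∈ T.divSpace a F) ∧
    ∀ F a ha b hb, T.transLin a b (f F a ha) = f F b hb

/-- `ψ` is a representative of the eigenwave `φ ∈ C^1(X; W_1) / B^1_div(X; W_1)`, for the given
choice of barycenters: up to the coboundary of a divisorial 0-cochain, its value on the simplex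
`E < F` is the difference of nearby mobile points of the end points. -/
def IsEigenwave (b : T.Cell → X) (ψ : T.WaveCochain) : Prop :=
  ∃ y, T.IsNearby b y ∧ ∃ f, T.IsDivCochain f ∧
    ∀ E F (h : E < F) a (ha : F.1 ⊆ T.U a),
      ψ.val E F h a ha =
        (T.pt a (y F) - T.pt a (y E)) + (f F a ha - f E a (Set.Subset.trans h.le ha))

/-- The coefficient that the cap product with `ψ` produces on the face `σ_{1…q+1}` of `σ`. -/
def capTerm {p q : ℕ} (ψ : T.WaveCochain) (γ : T.Chain p (q + 1)) (σ : T.BarSimplex (q + 1)) :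
    T.coeffs (p + 1) (T.tail σ 0) (T.tail σ (Fin.last q)) :=
  have h01 : σ 0 < T.tail σ 0 := σ.strictMono (Fin.succ_pos 0)
  have h1q : T.tail σ 0 ≤ T.tail σ (Fin.last q) := (T.tail σ).monotone (Fin.zero_le _)
  T.wedgePush p h01.le h1q
    ⟨ψ.val (σ 0) (T.tail σ 0) h01 (T.chartAt (T.tail σ (Fin.last q)))
      (Set.Subset.trans h1q (T.subset_chartAt _)), ψ.mem _ _ _ _ _⟩ (γ σ)

/-- The cap product `ψ ∩ (Σ β_σ σ) = Σ (ψ(σ_{01}) ∧ β_σ) σ_{1…q+1}`, as a map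
`C^bar_{q+1}(X; ℱ_p ⊗ ℝ) → C^bar_q(X; ℱ_{p+1} ⊗ ℝ)`. -/
def cap {p q : ℕ} (ψ : T.WaveCochain) (γ : T.Chain p (q + 1)) : T.Chain (p + 1) q :=
  ∑ σ : T.BarSimplex (q + 1), Pi.single (T.tail σ) (T.capTerm ψ γ σ)

/-! ### Konstruktor chains -/

/-- A finite mobile `k`-simplex with an ordering of its vertices, which orients it. -/
structure OrientedSimplex (k : ℕ) where
  /-- the underlying cell -/
  cell : T.Cell
  isFinite : T.IsFinite cell
  /-- the vertices, in order -/
  vert : Fin (k + 1) → X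
  injective : Function.Injective vert
  range_vert : Finset.univ.image vert = T.verts cell

/-- The volume element `(v₁ - v₀) ∧ ⋯ ∧ (v_k - v₀)` of an oriented simplex. -/
def OrientedSimplex.vol {T : UnimodularComplex X} {k : ℕ} (Δ : T.OrientedSimplex k)
    (a : Fin T.numCharts) : T.Ext a :=
  ExteriorAlgebra.ιMulti ℝ k fun i : Fin k => T.pt a (Δ.vert i.succ) - T.pt a (Δ.vert 0)

/-- The product of the vectors from `p` to the generators in `S`, in some order. -/
def wedgeSet (a : Fin T.numCharts) (p : X) (S : Finset (X ⊕ Fin (T.N a))) : T.Ext a :=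
  (S.toList.map fun g => ExteriorAlgebra.ι ℝ (T.vec a p g)).prod

/-- A volume element of the finite simplex `E`, in the chart `a`. -/
def simplexVol (a : Fin T.numCharts) (E : T.Cell) : T.Ext a :=
  T.wedgeSet a (T.base E) ((T.gens a E).erase (Sum.inl (T.base E)))

/-- The product of the vectors from `p` to the generators of `F` that are not in `E`. -/
def relVol (a : Fin T.numCharts) (p : X) (E F : T.Cell) : T.Ext a :=
  T.wedgeSet a p (T.gens a F \ T.gens a E)

/-- The sign with which a maximal flag `σ` from `Δ' = σ₀ ≤ Δ` to `F = {Δ q̄} = σ_m` enters the dual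
cell of `Δ'` in `F`, when `Δ'` and `q̄` are ordered as in `simplexVol` and `relVol`. With `u_i` the
vector towards the generator of `σ_i` that is not in `σ_{i-1}`, one has
`u_m ∧ ⋯ ∧ u_1 ∧ Vol_{Δ'} = ± Vol_Δ ∧ Vol_{q̄}`, and `±` is the sign. -/
def dualSign {k m : ℕ} (Δ : T.OrientedSimplex k) (σ : T.BarSimplex m) : ℝ :=
  let a := T.chartAt (σ (Fin.last m))
  let p := T.base (σ 0)
  if (List.ofFn fun i : Fin m => T.relVol a p (σ i.castSucc) (σ i.succ)).reverse.prod
      * T.simplexVol a (σ 0) = Δ.vol a * T.relVol a p Δ.cell (σ (Fin.last m))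
  then 1 else -1

/-- The volume element `Vol_{Δ' q̄} = Vol_{Δ'} ∧ Vol_{q̄}` (with the same orderings), where
`Δ' = σ₀` and `{Δ q̄}` is the last cell of `σ`. -/
def faceVol {k m : ℕ} (Δ : T.OrientedSimplex k) (σ : T.BarSimplex m) :
    T.Ext (T.chartAt (σ (Fin.last m))) :=
  T.simplexVol _ (σ 0) * T.relVol _ (T.base (σ 0)) Δ.cell (σ (Fin.last m))

lemma dirs_eq_empty {F : T.Cell} (hF : T.IsFinite F) {E : T.Cell} (hE : E ≤ F)
    (a : Fin T.numCharts) (ha : E.1 ⊆ T.U a) : T.dirs a E = ∅ := by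
  ext i
  simp only [dirs, divIndex, Finset.mem_filter, Finset.mem_univ, true_and, Finset.notMem_empty,
    iff_false, not_exists, not_and]
  intro x hx
  exact hF a x (hE hx) (ha hx) i

lemma verts_subset (F : T.Cell) {x : X} (hx : x ∈ T.verts F) : x ∈ F.1 := by
  simpa [verts, vertsIn] using (Finset.mem_filter.1 hx).2

lemma verts_mono {F G : T.Cell} (h : F ≤ G) : T.verts F ⊆ T.verts G := by
  intro x hx
  rw [verts, vertsIn, Finset.mem_filter] at hx ⊢
  exact ⟨hx.1, h hx.2⟩

lemma vec_mem_lin {a : Fin T.numCharts} {F : T.Cell} (ha : F.1 ⊆ T.U a) {p : X}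
    (hp : p ∈ T.verts F) {g : X ⊕ Fin (T.N a)} (hg : g ∈ T.gens a F) :
    T.vec a p g ∈ T.lin a F := by
  have hpF := T.verts_subset F hp
  have hpm := T.isMobile_vertex F.1 F.2 a ha p hp
  apply Submodule.subset_span
  rcases g with v | i
  · have hv : v ∈ T.verts F := by simpa [gens] using hg
    have hvF := T.verts_subset F hv
    exact ⟨v, ⟨hvF, ha hvF⟩, p, ⟨hpF, ha hpF⟩, T.isMobile_vertex F.1 F.2 a ha v hv, hpm, rfl⟩
  · have hi : i ∈ T.dirs a F := by simpa [gens] using hg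
    let z : Fin (T.N a) → ℝ := T.pt a p
    let x : TropAffine (T.N a) := fun n => ⟨((z n - (Pi.single i 1 : Fin (T.N a) → ℝ) n : ℝ) : EReal),
      EReal.coe_lt_top _⟩
    have hx : x ∈ T.chart a '' F.1 := by
      rw [T.image_cell F.1 F.2 a ha]
      refine ⟨z, subset_convexHull ℝ _ ?_, ?_⟩
      · exact Finset.mem_coe.2 (Finset.mem_image.2 ⟨p, hp, rfl⟩)
      · intro n
        by_cases hn : n = i
        · subst hn
          have h' : n ∈ divIndex (T.chart a) F.1 := hi
          rw [if_pos h']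
          simp only [x, Pi.single_eq_same]
          exact_mod_cast (by linarith : z n - 1 ≤ z n)
        · split_ifs <;> simp [x, hn]
    obtain ⟨w, hw, hwx⟩ := hx
    refine ⟨w, ⟨hw, ha hw⟩, p, ⟨hpF, ha hpF⟩, ?_, hpm, ?_⟩
    · rw [hwx]
      intro n
      exact EReal.coe_ne_bot _
    · have : T.pt a w = z - Pi.single i 1 := by
        funext n
        simp only [pt, hwx, realCoord, x, EReal.toReal_coe, Pi.sub_apply]
      rw [this]
      simp [vec, z]

lemma prod_mem_coeffs {E F : T.Cell} (hE : T.dirs (T.chartAt F) E = ∅)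
    (L : List (Fin (T.N (T.chartAt F)) → ℝ)) (hL : ∀ v ∈ L, v ∈ T.lin (T.chartAt F) F) {n : ℕ}
    (hn : L.length = n) : (L.map (ExteriorAlgebra.ι ℝ)).prod ∈ T.coeffs n E F := by
  subst hn
  apply Submodule.subset_span
  refine ⟨F, le_rfl, fun j => L.get j, fun j => hL _ (List.get_mem _ _), ?_⟩
  have hk : ∀ v : Fin (T.N (T.chartAt F)) → ℝ, killDirs ∅ v = v := by
    intro v
    ext i
    simp [killDirs]
  rw [ExteriorAlgebra.ιMulti_apply, hE]
  simp only [hk]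
  congr 1
  conv_lhs => rw [← List.ofFn_get L]
  rw [List.map_ofFn]
  rfl

lemma faceVol_mem {k m l r : ℕ} (Δ : T.OrientedSimplex k) (σ : T.BarSimplex m)
    (h0 : σ 0 ≤ Δ.cell) (hr : T.cellDim (σ 0) = r) (h1 : Δ.cell ≤ σ (Fin.last m))
    (hl : T.cellDim (σ (Fin.last m)) = T.cellDim Δ.cell + l) :
    T.faceVol Δ σ ∈ T.coeffs (l + r) (σ 0) (σ (Fin.last m)) := by
  have hsub := T.subset_chartAt (σ (Fin.last m))
  have hd0 := T.dirs_eq_empty Δ.isFinite h0 (T.chartAt (σ (Fin.last m)))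
    (Set.Subset.trans (h0.trans h1) hsub)
  have hdΔ := T.dirs_eq_empty Δ.isFinite le_rfl (T.chartAt (σ (Fin.last m)))
    (Set.Subset.trans h1 hsub)
  have hd0' := T.dirs_eq_empty Δ.isFinite h0 _ (T.subset_chartAt (σ 0))
  have hdΔ' := T.dirs_eq_empty Δ.isFinite le_rfl _ (T.subset_chartAt Δ.cell)
  have hb := T.base_mem (σ 0)
  have hbF := T.verts_mono (h0.trans h1) hb
  have hgens : ∀ {E F : T.Cell}, E ≤ F → T.gens (T.chartAt (σ (Fin.last m))) E ⊆
      T.gens (T.chartAt (σ (Fin.last m))) F := fun h =>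
    Finset.disjSum_mono (T.verts_mono h) (T.dirs_mono _ h)
  have hpos0 : 0 < (T.verts (σ 0)).card := Finset.card_pos.2 ⟨_, hb⟩
  have hposΔ : 0 < (T.verts Δ.cell).card := Finset.card_pos.2 ⟨_, T.base_mem _⟩
  have hposF : 0 < (T.verts (σ (Fin.last m))).card := Finset.card_pos.2 ⟨_, T.base_mem _⟩
  have hmem0 : Sum.inl (T.base (σ 0)) ∈ T.gens (T.chartAt (σ (Fin.last m))) (σ 0) := by
    simpa [gens] using hb
  have key := T.prod_mem_coeffs hd0
    ((((T.gens (T.chartAt (σ (Fin.last m))) (σ 0)).erase (Sum.inl (T.base (σ 0)))).toList.map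
        (T.vec _ (T.base (σ 0)))) ++
      ((T.gens (T.chartAt (σ (Fin.last m))) (σ (Fin.last m)) \
        T.gens (T.chartAt (σ (Fin.last m))) Δ.cell).toList.map (T.vec _ (T.base (σ 0)))))
    (n := l + r) ?_ ?_
  · have hfun : ∀ g, (⇑(ExteriorAlgebra.ι ℝ) ∘ T.vec (T.chartAt (σ (Fin.last m))) (T.base (σ 0))) g =
        ExteriorAlgebra.ι ℝ (T.vec (T.chartAt (σ (Fin.last m))) (T.base (σ 0)) g) := fun g => rfl
    rw [List.map_append, List.prod_append, List.map_map, List.map_map] at key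
    exact key
  · intro v hv
    rw [List.mem_append, List.mem_map, List.mem_map] at hv
    rcases hv with ⟨g, hg, rfl⟩ | ⟨g, hg, rfl⟩
    · rw [Finset.mem_toList] at hg
      exact T.vec_mem_lin hsub hbF (hgens (h0.trans h1) (Finset.mem_of_mem_erase hg))
    · rw [Finset.mem_toList] at hg
      exact T.vec_mem_lin hsub hbF (Finset.mem_sdiff.1 hg).1
  · rw [List.length_append, List.length_map, List.length_map, Finset.length_toList,
      Finset.length_toList, Finset.card_erase_of_mem hmem0, Finset.card_sdiff_of_subset (hgens h1)]
    simp only [gens, Finset.card_disjSum, hd0, hdΔ, Finset.card_empty]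
    simp only [cellDim, hd0', hdΔ', Finset.card_empty] at hr hl
    omega

/-- The konstruktor chain `c[-r] ∈ C^bar_m(X; ℱ_{l+r} ⊗ ℝ)`, `m = k + l - r`, of a propeller
`c = Σ ρ_{q̄} {Δ q̄} ∈ H_{2l}(Δ)`: the sum, over the faces `Δ'` of `Δ` of dimension `r` and over
`q̄`, of `ρ_{q̄} Vol_{Δ' q̄}` times the dual cell of `Δ'` in `{Δ q̄}`. The simplices of this
dual cell are the maximal flags from `Δ'` to `{Δ q̄}`. -/
def twist {k l : ℕ} (Δ : T.OrientedSimplex k) (c : T.propellers Δ.cell l) (r m : ℕ)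
    (_hm : m + r = k + l) : T.Chain (l + r) m := fun σ =>
  if h : (σ 0 ≤ Δ.cell ∧ T.cellDim (σ 0) = r) ∧ (Δ.cell ≤ σ (Fin.last m) ∧
      T.cellDim (σ (Fin.last m)) = T.cellDim Δ.cell + l) then
    (((c.1 ⟨σ (Fin.last m), h.2⟩ : ℚ) : ℝ) * T.dualSign Δ σ) •
      ⟨T.faceVol Δ σ, T.faceVol_mem Δ σ h.1.1 h.1.2 h.2.1 h.2.2⟩
  else 0

end UnimodularComplex

end Tropical11

end

/-! Compare coefficients on a flag `τ = (F₀ < ⋯ < F_m)`. The flags whose tail is `τ` arise by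
prepending a cell `E < F₀`, and such a flag occurs in `c[-r]` only if `E` is an `r`-face of `Δ` and
`F_m = {Δ q̄}`. Its length leaves no room for a jump in dimension, so `F₀` has exactly one generator
(vertex or divisorial direction) more than `E` (`cellDim_tail`).

If this generator lies outside `Δ`, it belongs to `q̄`. The wave value is tangent to `F₀`, hence a
combination of the factors of `Vol_{E q̄}`, and the wedge product vanishes
(`capTerm_twist_eq_zero`).

Otherwise `F₀` is a face of `Δ` and `E` is its facet opposite to a vertex `v`. Divisorial cochains
vanish on finite cells, so every representative takes the value `y_{F₀} - y_E` there. Modulo the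
tangent space of `E` this is `t_v (v - p)`, where `p` is a vertex of `E` and `t_v` is the
barycentric coordinate of `y_{F₀}` at `v` (`ι_sub_mul_simplexVol`). Wedging with `Vol_E` gives `t_v
η Vol_{F₀}` with `η = ±1`, and the sign of the longer flag is `η` times that of `τ`. The two `η`
cancel, so `E` contributes `t_v` times the coefficient of `τ` in `c[-r-1]` (`capTerm_twist_of_le`).
Summing over the vertices of `F₀` gives the factor `∑ t_v = 1`, whatever points `y` were chosen.

Two supports are needed. Faces of a common cell correspond to subsets of its generators
(`eq_cellFace`, `cellDim_add_one`). Volume elements from different vertices and orders are products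
of lists that span the same subgroup, so they agree up to sign (`prod_map_ι_eq_or_neg`);
unimodularity makes them nonzero, so the sign is well defined. -/

noncomputable section

namespace Tropical11

/-! ### Products of vectors in the exterior algebra -/

section Exterior

variable {V : Type*} [AddCommGroup V] [Module ℝ V]

lemma prod_map_ι_eq_ιMulti (L : List V) :
    (L.map (ExteriorAlgebra.ι ℝ)).prod = ExteriorAlgebra.ιMulti ℝ L.length L.get := by
  rw [ExteriorAlgebra.ιMulti_apply]
  conv_lhs => rw [← List.ofFn_get L]
  rw [List.map_ofFn]
  rfl

lemma prod_map_ι_eq_zero {L : List V} (h : ¬ L.Nodup) :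
    (L.map (ExteriorAlgebra.ι ℝ)).prod = 0 := by
  rw [prod_map_ι_eq_ιMulti]
  rw [List.nodup_iff_injective_get, Function.Injective] at h
  push Not at h
  obtain ⟨i, j, hij, hne⟩ := h
  exact AlternatingMap.map_eq_zero_of_eq _ _ hij hne

/-- By linearity `x` may be taken from the list, and then a factor is repeated. This one fact
removes the flags that leave `Δ` and allows base points to be changed. -/
lemma ι_mul_prod_map_ι_eq_zero {L : List V} {x : V} (hx : x ∈ Submodule.span ℝ {y | y ∈ L}) :
    ExteriorAlgebra.ι ℝ x * (L.map (ExteriorAlgebra.ι ℝ)).prod = 0 := by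
  induction hx using Submodule.span_induction with
  | mem x hx =>
    have := prod_map_ι_eq_zero (L := x :: L) (by simp only [List.nodup_cons]; exact fun h => h.1 hx)
    simpa using this
  | zero => simp
  | add x y _ _ hx hy => rw [map_add, add_mul, hx, hy, add_zero]
  | smul t x _ hx => rw [map_smul, smul_mul_assoc, hx, smul_zero]

lemma prod_map_ι_mul_ι_eq_zero {L : List V} {x : V} (hx : x ∈ Submodule.span ℝ {y | y ∈ L}) :
    (L.map (ExteriorAlgebra.ι ℝ)).prod * ExteriorAlgebra.ι ℝ x = 0 := by
  induction hx using Submodule.span_induction with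
  | mem x hx =>
    have := prod_map_ι_eq_zero (L := L ++ [x]) (by
      simp only [List.nodup_append]
      exact fun h => h.2.2 x hx x (by simp) rfl)
    simpa using this
  | zero => simp
  | add x y _ _ hx hy => rw [map_add, mul_add, hx, hy, add_zero]
  | smul t x _ hx => rw [map_smul, mul_smul_comm, hx, smul_zero]

/-- Changing the factors on the left of a product by vectors in the span of its right part. -/
lemma prod_map_mul_congr_left {G : Type*} (f f' : G → V) (L : List G) (K : List V)
    (h : ∀ g ∈ L, f g - f' g ∈ Submodule.span ℝ {y | y ∈ K}) :
    (L.map fun g => ExteriorAlgebra.ι ℝ (f g)).prod * (K.map (ExteriorAlgebra.ι ℝ)).prod =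
      (L.map fun g => ExteriorAlgebra.ι ℝ (f' g)).prod * (K.map (ExteriorAlgebra.ι ℝ)).prod := by
  induction L with
  | nil => rfl
  | cons g L ih =>
    have h0 := h g (by simp)
    have ih := ih fun g hg => h g (by simp [hg])
    have hz := ι_mul_prod_map_ι_eq_zero (L := L.map f' ++ K) (x := f g - f' g)
      (Submodule.span_mono (fun y hy => by simp at hy ⊢; exact Or.inr hy) h0)
    rw [List.map_append, List.prod_append, List.map_map] at hz
    rw [List.map_cons, List.map_cons, List.prod_cons, List.prod_cons, mul_assoc, mul_assoc, ih,
      ← sub_eq_zero, ← sub_mul, ← map_sub]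
    exact hz

/-- Changing the factors on the right of a product by vectors in the span of its left part. -/
lemma mul_prod_map_congr_right {G : Type*} (f f' : G → V) (L : List G) (K : List V)
    (h : ∀ g ∈ L, f g - f' g ∈ Submodule.span ℝ {y | y ∈ K}) :
    (K.map (ExteriorAlgebra.ι ℝ)).prod * (L.map fun g => ExteriorAlgebra.ι ℝ (f g)).prod =
      (K.map (ExteriorAlgebra.ι ℝ)).prod * (L.map fun g => ExteriorAlgebra.ι ℝ (f' g)).prod := by
  induction L using List.reverseRecOn with
  | nil => rfl
  | append_singleton L g ih =>
    have h0 := h g (by simp)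
    have ih := ih fun g hg => h g (by simp [hg])
    have hz := prod_map_ι_mul_ι_eq_zero (L := K ++ L.map f') (x := f g - f' g)
      (Submodule.span_mono (fun y hy => by simp at hy ⊢; exact Or.inl hy) h0)
    rw [List.map_append, List.prod_append, List.map_map] at hz
    simp only [List.map_append, List.prod_append, List.map_cons, List.map_nil,
      List.prod_singleton]
    rw [← mul_assoc, ← mul_assoc, ih, ← sub_eq_zero, ← mul_sub, ← map_sub]
    exact hz

/-- Pulled back along `e_j ↦ w j`, both sides are alternating `n`-forms on `ℝⁿ` evaluated at the
rows of `M`; such forms are determined by their value on the standard basis. -/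
lemma alternatingMap_matrix {W : Type*} [AddCommGroup W] [Module ℝ W] {n : ℕ}
    (f : V [⋀^Fin n]→ₗ[ℝ] W) (M : Matrix (Fin n) (Fin n) ℝ) (w : Fin n → V) :
    f (fun i => ∑ j, M i j • w j) = M.det • f w := by
  let φ : (Fin n → ℝ) →ₗ[ℝ] V := Fintype.linearCombination ℝ w
  have h := congrArg (fun g : (Fin n → ℝ) [⋀^Fin n]→ₗ[ℝ] W => g (fun i => M i))
    (Module.Basis.ext_alternating (f := f.compLinearMap φ)
      (g := (LinearMap.toSpanSingleton ℝ W (f w)).compAlternatingMap Matrix.detRowAlternating)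
      (Pi.basisFun ℝ (Fin n)) (by
        intro v hv
        obtain ⟨σ, rfl⟩ : ∃ σ : Equiv.Perm (Fin n), v = σ :=
          ⟨Equiv.ofBijective v hv.bijective_of_finite, rfl⟩
        have h1 : (fun i => (Pi.basisFun ℝ (Fin n)) (σ i)) =
            (fun i => (Pi.basisFun ℝ (Fin n)) i) ∘ σ := rfl
        rw [h1, AlternatingMap.map_perm, AlternatingMap.map_perm]
        congr 1
        have h2 : (Matrix.detRowAlternating fun i => (Pi.basisFun ℝ (Fin n)) i) = (1 : ℝ) := by
          rw [← Pi.basisFun_det]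
          exact Module.Basis.det_self _
        rw [LinearMap.compAlternatingMap_apply, h2]
        simp [φ, Fintype.linearCombination_apply_single]))
  simp only [AlternatingMap.compLinearMap_apply, φ, Fintype.linearCombination_apply] at h
  exact h

lemma exists_int_matrix {n : ℕ} {v w : Fin n → V}
    (h : ∀ i, v i ∈ Submodule.span ℤ (Set.range w)) :
    ∃ M : Matrix (Fin n) (Fin n) ℤ, ExteriorAlgebra.ιMulti ℝ n v =
      ((M.det : ℤ) : ℝ) • ExteriorAlgebra.ιMulti ℝ n w := by
  simp_rw [Submodule.mem_span_range_iff_exists_fun] at h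
  choose M hM using h
  refine ⟨Matrix.of M, ?_⟩
  have h2 : v = fun i => ∑ j, ((Matrix.of M).map (Int.cast : ℤ → ℝ)) i j • w j := by
    funext i
    rw [← hM i]
    simp [Int.cast_smul_eq_zsmul]
  rw [h2, alternatingMap_matrix, Int.cast_det]

/-- The two families are related by integer matrices `M` and `M'`. Unless both products vanish,
going back and forth forces `det M' * det M = 1` in `ℤ`. Independence of the families is not needed.
-/
lemma ιMulti_eq_or_neg {n : ℕ} {v w : Fin n → V}
    (h : ∀ i, v i ∈ Submodule.span ℤ (Set.range w))
    (h' : ∀ i, w i ∈ Submodule.span ℤ (Set.range v)) :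
    ExteriorAlgebra.ιMulti ℝ n v = ExteriorAlgebra.ιMulti ℝ n w ∨
      ExteriorAlgebra.ιMulti ℝ n v = -ExteriorAlgebra.ιMulti ℝ n w := by
  obtain ⟨M, hM⟩ := exists_int_matrix h
  obtain ⟨M', hM'⟩ := exists_int_matrix h'
  by_cases h0 : ExteriorAlgebra.ιMulti ℝ n w = 0
  · left; rw [hM, h0, smul_zero]
  · have h1 : (((M'.det * M.det : ℤ) : ℝ) - 1) • ExteriorAlgebra.ιMulti ℝ n w = 0 := by
      rw [sub_smul, one_smul, Int.cast_mul, mul_smul, ← hM, ← hM', sub_self]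
    have h2 := (smul_eq_zero.1 h1).resolve_right h0
    have h3 : M'.det * M.det = 1 := by exact_mod_cast sub_eq_zero.1 h2
    rcases Int.eq_one_or_neg_one_of_mul_eq_one (by rwa [mul_comm] at h3 : M.det * M'.det = 1)
      with h4 | h4
    · left; rw [hM, h4]; simp
    · right; rw [hM, h4]; simp

/-- The product of a list of vectors depends, up to sign, on its length and the subgroup it spans. -/
lemma prod_map_ι_eq_or_neg {L L' : List V} (hlen : L.length = L'.length)
    (h : ∀ x ∈ L, x ∈ Submodule.span ℤ {y | y ∈ L'})
    (h' : ∀ x ∈ L', x ∈ Submodule.span ℤ {y | y ∈ L}) :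
    (L.map (ExteriorAlgebra.ι ℝ)).prod = (L'.map (ExteriorAlgebra.ι ℝ)).prod ∨
      (L.map (ExteriorAlgebra.ι ℝ)).prod = -(L'.map (ExteriorAlgebra.ι ℝ)).prod := by
  obtain ⟨n, v, rfl⟩ : ∃ n, ∃ v : Fin n → V, L = List.ofFn v := ⟨_, L.get, (List.ofFn_get L).symm⟩
  obtain ⟨m, w, rfl⟩ : ∃ n, ∃ v : Fin n → V, L' = List.ofFn v :=
    ⟨_, L'.get, (List.ofFn_get L').symm⟩
  simp only [List.length_ofFn] at hlen
  subst hlen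
  have hs : ∀ u : Fin n → V, {y | y ∈ List.ofFn u} = Set.range u := by
    intro u; ext; simp [List.mem_ofFn]
  rw [hs] at h h'
  have := ιMulti_eq_or_neg (v := v) (w := w) (fun i => h _ (by simp [List.mem_ofFn]))
    (fun i => h' _ (by simp [List.mem_ofFn]))
  simpa only [ExteriorAlgebra.ιMulti_apply, List.map_ofFn, Function.comp_def] using this

/-- A left inverse `φ` of `e_i ↦ v i` pulls the determinant back to an alternating form with value
`1` on `v`, and this form factors through the exterior algebra. -/
lemma ιMulti_ne_zero {n : ℕ} {v : Fin n → V} (hv : LinearIndependent ℝ v) :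
    ExteriorAlgebra.ιMulti ℝ n v ≠ 0 := by
  obtain ⟨φ, hφ⟩ := LinearMap.exists_leftInverse_of_injective (Fintype.linearCombination ℝ v)
    (LinearMap.ker_eq_bot.2 (linearIndependent_iff_injective_fintypeLinearCombination.1 hv))
  have hφv : ∀ i, φ (v i) = (Pi.basisFun ℝ (Fin n)) i := by
    intro i
    have := LinearMap.congr_fun hφ (Pi.single i 1)
    simpa [Fintype.linearCombination_apply_single] using this
  intro h0
  -- A functional on the whole exterior algebra needs a form in each degree; it is zero outside
  -- degree `n`.
  let g : ∀ i : ℕ, V [⋀^Fin i]→ₗ[ℝ] ℝ :=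
    Pi.single n ((Pi.basisFun ℝ (Fin n)).det.compLinearMap φ)
  have h := congrArg (ExteriorAlgebra.liftAlternating (R := ℝ) g) h0
  rw [ExteriorAlgebra.liftAlternating_apply_ιMulti, map_zero] at h
  have h1 : g n = (Pi.basisFun ℝ (Fin n)).det.compLinearMap φ := Pi.single_eq_same _ _
  rw [h1, AlternatingMap.compLinearMap_apply] at h
  have h2 : (fun i => φ (v i)) = ⇑(Pi.basisFun ℝ (Fin n)) := funext hφv
  simp only [h2, Module.Basis.det_self] at h
  exact one_ne_zero h

lemma prod_map_ι_ne_zero {G : Type*} {f : G → V} {L : List G} (hL : L.Nodup)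
    (hf : LinearIndependent ℝ fun g : {g // g ∈ L} => f g) :
    (L.map fun g => ExteriorAlgebra.ι ℝ (f g)).prod ≠ 0 := by
  have h1 : (L.map fun g => ExteriorAlgebra.ι ℝ (f g)).prod =
      ExteriorAlgebra.ιMulti ℝ L.length (fun i => f (L.get i)) := by
    rw [ExteriorAlgebra.ιMulti_apply]
    conv_lhs => rw [← List.ofFn_get L]
    rw [List.map_ofFn]
    rfl
  rw [h1]
  apply ιMulti_ne_zero
  exact hf.comp (fun i : Fin L.length => ⟨L.get i, List.get_mem _ _⟩) (fun i j hij =>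
    List.nodup_iff_injective_get.1 hL (by simpa using congrArg Subtype.val hij))

end Exterior

/-! ### Mobile points and coordinates in tropical affine space -/

lemma coe_realCoord {N : ℕ} {x : TropAffine N} (hx : IsMobile x) (i : Fin N) :
    ((realCoord x i : ℝ) : EReal) = x i :=
  EReal.coe_toReal (ne_of_lt (x i).2) (hx i)

lemma coe_finset_sum {ι : Type*} (s : Finset ι) (f : ι → ℝ) :
    ((∑ i ∈ s, f i : ℝ) : EReal) = ∑ i ∈ s, (f i : EReal) := by
  induction s using Finset.induction_on with
  | empty => simp
  | insert i s hi ih => rw [Finset.sum_insert hi, Finset.sum_insert hi, EReal.coe_add, ih]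

lemma IsAffineValue.coe_eq {M N : ℕ} {A : Matrix (Fin M) (Fin N) ℤ} {c : Fin M → ℝ}
    {x : TropAffine N} {y : TropAffine M} (h : IsAffineValue A c x y) (hx : IsMobile x)
    (i : Fin M) :
    (y i : EReal) = ((Matrix.toLin' (A.map (Int.cast : ℤ → ℝ)) (realCoord x) i + c i : ℝ) :
      EReal) := by
  rw [h.2 i, EReal.coe_add, Matrix.toLin'_apply, Matrix.mulVec, dotProduct, coe_finset_sum]
  congr 1
  refine Finset.sum_congr rfl fun j _ => ?_
  rw [← coe_realCoord hx j, ← EReal.coe_mul]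
  rfl

lemma simplexCone_mono {N : ℕ} {V V' : Finset (Fin N → ℝ)} {I I' : Finset (Fin N)}
    (hV : V ⊆ V') (hI : I ⊆ I') : simplexCone V I ⊆ simplexCone V' I' := by
  rintro x ⟨z, hz, hx⟩
  refine ⟨z, convexHull_mono (Finset.coe_subset.2 hV) hz, fun i => ?_⟩
  have := hx i
  by_cases h : i ∈ I
  · rw [if_pos h] at this
    rwa [if_pos (hI h)]
  · rw [if_neg h] at this
    split_ifs
    · exact this.le
    · exact this

lemma sub_eq_sum_single {N : ℕ} {I : Finset (Fin N)} {x z : Fin N → ℝ}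
    (h : ∀ i ∉ I, x i = z i) :
    x - z = ∑ i ∈ I, (z i - x i) • (-Pi.single i 1 : Fin N → ℝ) := by
  ext n
  simp only [Pi.sub_apply, Finset.sum_apply, Pi.smul_apply, Pi.neg_apply, smul_eq_mul,
    Pi.single_apply, mul_neg, mul_ite, mul_one, mul_zero, Finset.sum_neg_distrib,
    Finset.sum_ite_eq]
  split_ifs with hn
  · ring
  · rw [h n hn]; ring

/-- The coordinates of a mobile point of a cell with respect to vertices and directions. -/
lemma exists_coords_of_mem_simplexCone {X : Type*} {N : ℕ} {f : X → Fin N → ℝ} {V : Finset X}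
    {I : Finset (Fin N)} (hf : Set.InjOn f V) {x : TropAffine N} (hx : IsMobile x)
    (h : x ∈ simplexCone (V.image f) I) :
    ∃ (t : X → ℝ) (c : Fin N → ℝ), ∑ v ∈ V, t v = 1 ∧
      realCoord x = ∑ v ∈ V, t v • f v + ∑ i ∈ I, c i • (-Pi.single i 1 : Fin N → ℝ) := by
  obtain ⟨z, hz, hxz⟩ := h
  obtain ⟨w, -, hw1, hw⟩ := Finset.mem_convexHull'.1 hz
  rw [Finset.sum_image hf] at hw1 hw
  refine ⟨fun v => w (f v), fun i => z i - realCoord x i, hw1, ?_⟩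
  rw [hw, ← sub_eq_iff_eq_add', ← sub_eq_sum_single]
  intro i hi
  have := hxz i
  rw [if_neg hi, ← coe_realCoord hx] at this
  exact_mod_cast this

/-- The determinant of a lattice basis is a unit of `ℤ`, hence remains a unit in `ℝ`. -/
lemma linearIndependent_of_int_basis {N : ℕ} (b : Module.Basis (Fin N) ℤ (Fin N → ℤ)) :
    LinearIndependent ℝ fun i => (fun n => ((b i n : ℤ) : ℝ)) := by
  have h : IsUnit ((Int.castRingHom ℝ).mapMatrix (Matrix.of fun i => b i)) := by
    rw [Matrix.isUnit_iff_isUnit_det, ← RingHom.map_det]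
    apply IsUnit.map
    have := (Pi.basisFun ℤ (Fin N)).isUnit_det b
    rwa [Pi.basisFun_det] at this
  exact Matrix.linearIndependent_rows_iff_isUnit.2 h

namespace UnimodularComplex

variable {X : Type*} [TopologicalSpace X] (T : UnimodularComplex X)

/-! ### Change of charts -/

section Overlap

variable {T}

lemma pt_overlap {a b : Fin T.numCharts} {x : X} (ha : x ∈ T.U a) (hb : x ∈ T.U b)
    (hx : IsMobile (T.chart a x)) : T.pt b x = T.transLin a b (T.pt a x) + T.shift a b := by
  ext i
  have := (T.trans_spec a b x ⟨ha, hb⟩).coe_eq hx i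
  simp only [pt, realCoord, this, EReal.toReal_coe]
  rfl

lemma isMobile_overlap {a b : Fin T.numCharts} {x : X} (ha : x ∈ T.U a) (hb : x ∈ T.U b)
    (hx : IsMobile (T.chart a x)) : IsMobile (T.chart b x) := by
  intro i
  rw [(T.trans_spec a b x ⟨ha, hb⟩).coe_eq hx i]
  exact EReal.coe_ne_bot _

lemma lin_le_map_transLin {a b : Fin T.numCharts} {F : T.Cell} (ha : F.1 ⊆ T.U a) :
    T.lin b F ≤ (T.lin a F).map (T.transLin a b) := by
  refine Submodule.span_le.2 ?_
  rintro w ⟨x, hx, x', hx', hm, hm', rfl⟩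
  have h := isMobile_overlap hx.2 (ha hx.1) hm
  have h' := isMobile_overlap hx'.2 (ha hx'.1) hm'
  refine ⟨T.pt a x - T.pt a x', Submodule.subset_span
    ⟨x, ⟨hx.1, ha hx.1⟩, x', ⟨hx'.1, ha hx'.1⟩, h, h', rfl⟩, ?_⟩
  rw [pt_overlap (ha hx.1) hx.2 h, pt_overlap (ha hx'.1) hx'.2 h', map_sub]
  abel

/-- Each tangent space lies in the image of the other under an overlap differential, so the ranks
agree without any discussion of injectivity. -/
lemma finrank_lin_eq {a b : Fin T.numCharts} {F : T.Cell} (ha : F.1 ⊆ T.U a)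
    (hb : F.1 ⊆ T.U b) : Module.finrank ℝ (T.lin a F) = Module.finrank ℝ (T.lin b F) :=
  le_antisymm
    ((Submodule.finrank_mono (lin_le_map_transLin hb)).trans (Submodule.finrank_map_le _ _))
    ((Submodule.finrank_mono (lin_le_map_transLin ha)).trans (Submodule.finrank_map_le _ _))

end Overlap

/-! ### Generators, dimension and faces of a cell in a chart -/

section Chart

variable {T} {a : Fin T.numCharts} {F : T.Cell}

lemma injOn_pt : Set.InjOn (T.pt a) {x | x ∈ T.U a ∧ IsMobile (T.chart a x)} := by
  intro x hx y hy h
  refine Set.injOn_iff_injective.2 (T.isEmbedding a).injective hx.1 hy.1 ?_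
  funext i
  apply Subtype.ext
  rw [← coe_realCoord hx.2, ← coe_realCoord hy.2]
  exact congrArg _ (congrFun h i)

lemma vertex_mem (ha : F.1 ⊆ T.U a) {v : X} (hv : v ∈ T.verts F) :
    v ∈ T.U a ∧ IsMobile (T.chart a v) :=
  ⟨ha (T.verts_subset F hv), T.isMobile_vertex F.1 F.2 a ha v hv⟩

lemma injOn_pt_verts (ha : F.1 ⊆ T.U a) : Set.InjOn (T.pt a) (T.verts F) :=
  injOn_pt.mono fun _ hv => vertex_mem ha hv

lemma inl_mem_gens {v : X} : Sum.inl v ∈ T.gens a F ↔ v ∈ T.verts F := by simp [gens]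

lemma inr_mem_gens {i : Fin (T.N a)} : Sum.inr i ∈ T.gens a F ↔ i ∈ T.dirs a F := by simp [gens]

lemma vec_self (p : X) : T.vec a p (Sum.inl p) = 0 := sub_self _

/-- The vectors from a vertex of a cell to its other generators are linearly independent. -/
lemma linearIndepOn_vec (ha : F.1 ⊆ T.U a) {p : X} (hp : p ∈ T.verts F) :
    LinearIndepOn ℝ (T.vec a p) (((T.gens a F).erase (Sum.inl p) : Finset _) : Set _) := by
  obtain ⟨b, j, hj, hl, hr⟩ := (T.isUnimodular F.1 F.2 a ha).2 (T.pt a p)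
    (Finset.mem_image.2 ⟨p, hp, rfl⟩)
  have hex : ∀ g : {g // g ∈ (((T.gens a F).erase (Sum.inl p) : Finset _) : Set _)},
      ∃ s : {v // v ∈ (vertsIn T.vertices F.1).image (fun v => realCoord (T.chart a v)) ∧
        v ≠ T.pt a p} ⊕ {i // i ∈ divIndex (T.chart a) F.1},
        Sum.map Subtype.val Subtype.val s = Sum.map (T.pt a) id g.1 := by
    rintro ⟨g, hg⟩
    rw [Finset.mem_coe, Finset.mem_erase] at hg
    rcases g with v | i
    · have hv := inl_mem_gens.1 hg.2
      refine ⟨Sum.inl ⟨T.pt a v, Finset.mem_image.2 ⟨v, hv, rfl⟩, fun h => hg.1 ?_⟩, rfl⟩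
      rw [injOn_pt_verts ha hv hp h]
    · exact ⟨Sum.inr ⟨i, inr_mem_gens.1 hg.2⟩, rfl⟩
  choose s hs using hex
  have hsinj : Function.Injective s := by
    rintro ⟨g, hg⟩ ⟨g', hg'⟩ h
    have h1 := hs ⟨g, hg⟩
    rw [h, hs ⟨g', hg'⟩] at h1
    rw [Finset.mem_coe, Finset.mem_erase] at hg hg'
    apply Subtype.ext
    rcases g with v | i <;> rcases g' with v' | i' <;> simp only [Sum.map_inl, Sum.map_inr,
      Sum.inl.injEq, Sum.inr.injEq, reduceCtorEq, id] at h1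
    · exact congrArg Sum.inl (injOn_pt_verts ha (inl_mem_gens.1 hg.2) (inl_mem_gens.1 hg'.2) h1.symm)
    · exact congrArg Sum.inr h1.symm
  have key := (linearIndependent_of_int_basis b).comp (j ∘ s) (hj.comp hsinj)
  have hfun : (fun g : (((T.gens a F).erase (Sum.inl p) : Finset _) : Set _) => T.vec a p g.1) =
      (fun i => (fun n => ((b i n : ℤ) : ℝ))) ∘ j ∘ s := by
    funext ⟨g, hg⟩
    have h1 := hs ⟨g, hg⟩
    simp only [Function.comp_apply]
    rcases hs' : s ⟨g, hg⟩ with v | i <;> rw [hs'] at h1 <;> rcases g with v' | i' <;>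
      simp only [Sum.map_inl, Sum.map_inr, Sum.inl.injEq, Sum.inr.injEq, reduceCtorEq, id] at h1
    · rw [← hl v, h1]
      rfl
    · rw [hr i, h1]
      ext n
      simp [vec, Pi.single_apply]
  rw [LinearIndepOn, hfun]
  exact key

lemma lin_eq_span (ha : F.1 ⊆ T.U a) {p : X} (hp : p ∈ T.verts F) :
    T.lin a F = Submodule.span ℝ (T.vec a p '' (T.gens a F)) := by
  apply le_antisymm
  · have key : ∀ x ∈ F.1, IsMobile (T.chart a x) →
        T.pt a x - T.pt a p ∈ Submodule.span ℝ (T.vec a p '' (T.gens a F)) := by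
      intro x hx hm
      have hc : T.chart a x ∈ T.chart a '' F.1 := ⟨x, hx, rfl⟩
      rw [T.image_cell F.1 F.2 a ha] at hc
      obtain ⟨t, c, ht, h⟩ := exists_coords_of_mem_simplexCone (f := T.pt a)
        (injOn_pt_verts ha) hm hc
      have h2 : T.pt a x - T.pt a p = ∑ v ∈ T.verts F, t v • T.vec a p (Sum.inl v) +
          ∑ i ∈ T.dirs a F, c i • T.vec a p (Sum.inr i) := by
        simp only [vec, smul_sub, Finset.sum_sub_distrib, ← Finset.sum_smul]
        have ht' : ∑ v ∈ T.verts F, t v = 1 := ht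
        rw [ht', one_smul, pt, h]
        simp only [verts, dirs]
        abel
      rw [h2]
      refine Submodule.add_mem _ (Submodule.sum_mem _ fun v hv => Submodule.smul_mem _ _ ?_)
        (Submodule.sum_mem _ fun i hi => Submodule.smul_mem _ _ ?_)
      · exact Submodule.subset_span ⟨_, inl_mem_gens.2 hv, rfl⟩
      · exact Submodule.subset_span ⟨_, inr_mem_gens.2 hi, rfl⟩
    refine Submodule.span_le.2 ?_
    rintro w ⟨x, hx, x', hx', hm, hm', rfl⟩
    have := Submodule.sub_mem _ (key x hx.1 hm) (key x' hx'.1 hm')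
    simpa using this
  · refine Submodule.span_le.2 ?_
    rintro _ ⟨g, hg, rfl⟩
    exact T.vec_mem_lin ha hp hg

lemma span_vec_erase (S : Finset (X ⊕ Fin (T.N a))) (p : X) :
    Submodule.span ℝ (T.vec a p '' (S.erase (Sum.inl p) : Finset _)) =
      Submodule.span ℝ (T.vec a p '' S) := by
  apply le_antisymm
  · exact Submodule.span_mono (Set.image_mono (Finset.coe_subset.2 (Finset.erase_subset _ _)))
  · refine Submodule.span_le.2 ?_
    rintro _ ⟨g, hg, rfl⟩
    by_cases h : g = Sum.inl p
    · subst h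
      rw [vec_self]
      exact Submodule.zero_mem _
    · exact Submodule.subset_span ⟨g, Finset.mem_coe.2 (Finset.mem_erase.2 ⟨h, hg⟩), rfl⟩

lemma finrank_lin (ha : F.1 ⊆ T.U a) : Module.finrank ℝ (T.lin a F) + 1 = (T.gens a F).card := by
  have hp := T.base_mem F
  have hli := linearIndepOn_vec ha hp
  have h1 := finrank_span_eq_card hli
  have h2 : Set.range (fun g : (((T.gens a F).erase (Sum.inl (T.base F)) : Finset _) : Set _) =>
      T.vec a (T.base F) g.1) =
      T.vec a (T.base F) '' ((T.gens a F).erase (Sum.inl (T.base F)) : Finset _) := by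
    rw [Set.image_eq_range]
  rw [h2, span_vec_erase, ← lin_eq_span ha hp] at h1
  simp only [Finset.coe_sort_coe, Fintype.card_coe] at h1
  rw [h1, Finset.card_erase_add_one (inl_mem_gens.2 hp)]

/-- `cellDim` counts directions in the chart chosen for `F`. The count is the same in every chart
around `F` because the rank of the tangent space is; the extra `1` is the vertex used as origin. -/
lemma cellDim_add_one (ha : F.1 ⊆ T.U a) : T.cellDim F + 1 = (T.gens a F).card := by
  have h := finrank_lin (T.subset_chartAt F)
  rw [finrank_lin_eq (T.subset_chartAt F) ha, finrank_lin ha] at h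
  -- A cell has a vertex, so the truncated subtraction in `cellDim` is a true one.
  have hpos : 0 < (T.verts F).card := Finset.card_pos.2 ⟨_, T.base_mem F⟩
  rw [h, cellDim, gens, Finset.card_disjSum]
  omega

/-- If `v` were not in `V`, its coordinates with respect to `V` and `I` would be a linear relation
among the vectors from `v`, with coefficients at `V` of sum one, against `linearIndepOn_vec`. -/
lemma vertex_mem_of_mem_simplexCone (ha : F.1 ⊆ T.U a) {V : Finset X} (hV : V ⊆ T.verts F)
    {I : Finset (Fin (T.N a))} (hI : I ⊆ T.dirs a F) {v : X} (hv : v ∈ T.verts F)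
    (h : T.chart a v ∈ simplexCone (V.image fun v => realCoord (T.chart a v)) I) : v ∈ V := by
  by_contra hvV
  obtain ⟨t, c, ht, h⟩ := exists_coords_of_mem_simplexCone (f := T.pt a)
    ((injOn_pt_verts ha).mono (Finset.coe_subset.2 hV)) (vertex_mem ha hv).2 h
  have hsub : V.disjSum I ⊆ (T.gens a F).erase (Sum.inl v) := by
    intro g hg
    rw [Finset.mem_erase]
    refine ⟨?_, Finset.disjSum_mono hV hI hg⟩
    rintro rfl
    exact hvV (by simpa using hg)
  have hli := (linearIndepOn_vec ha hv).mono (Finset.coe_subset.2 hsub)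
  have h0 := linearIndepOn_finset_iff.1 hli (Sum.elim t c) (by
    rw [Finset.sum_disjSum]
    simp only [Sum.elim_inl, Sum.elim_inr, vec, smul_sub, Finset.sum_sub_distrib,
      ← Finset.sum_smul]
    rw [ht, one_smul, pt, h]
    abel)
  rw [Finset.sum_eq_zero fun v hv => by simpa using h0 (Sum.inl v) (by simpa using hv)] at ht
  exact zero_ne_one ht

lemma verts_of_eq_cellFace (ha : F.1 ⊆ T.U a) {V : Finset X} (hV : V ⊆ T.verts F)
    {I : Finset (Fin (T.N a))} (hI : I ⊆ T.dirs a F) {E : T.Cell}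
    (hE : E.1 = cellFace (T.chart a) F.1 V I) : T.verts E = V := by
  ext v
  constructor
  · intro hv
    have h := T.verts_subset E hv
    rw [hE] at h
    exact vertex_mem_of_mem_simplexCone ha hV hI
      (Finset.mem_filter.2 ⟨(Finset.mem_filter.1 hv).1, h.1⟩) h.2
  · intro hv
    have hv' := Finset.mem_filter.1 (hV hv)
    refine Finset.mem_filter.2 ⟨hv'.1, ?_⟩
    rw [hE]
    refine ⟨hv'.2, T.pt a v, subset_convexHull ℝ _
      (Finset.mem_coe.2 (Finset.mem_image.2 ⟨v, hv, rfl⟩)), fun i => ?_⟩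
    have := coe_realCoord (vertex_mem ha (hV hv)).2 i
    split_ifs
    · exact this.ge
    · exact this.symm

lemma dirs_of_eq_cellFace (ha : F.1 ⊆ T.U a) {V : Finset X} (hV : V ⊆ T.verts F)
    (hne : V.Nonempty) {I : Finset (Fin (T.N a))} (hI : I ⊆ T.dirs a F) {E : T.Cell}
    (hE : E.1 = cellFace (T.chart a) F.1 V I) : T.dirs a E = I := by
  ext i
  simp only [dirs, divIndex, Finset.mem_filter, Finset.mem_univ, true_and, hE]
  constructor
  · rintro ⟨x, ⟨hxF, z, hz, hx⟩, hxi⟩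
    by_contra hi
    have := hx i
    rw [if_neg hi, hxi] at this
    exact EReal.coe_ne_bot _ this.symm
  · intro hi
    obtain ⟨v, hv⟩ := hne
    -- The witness is a vertex of the face with all coordinates in `I` moved to `-∞`.
    let x : TropAffine (T.N a) := fun n => if n ∈ I then ⟨⊥, Set.mem_Iio.2 bot_lt_top⟩ else
      ⟨(T.pt a v n : EReal), EReal.coe_lt_top _⟩
    have hx : x ∈ simplexCone (V.image fun v => realCoord (T.chart a v)) I := by
      refine ⟨T.pt a v, subset_convexHull ℝ _
        (Finset.mem_coe.2 (Finset.mem_image.2 ⟨v, hv, rfl⟩)), fun n => ?_⟩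
      by_cases hn : n ∈ I <;> simp [x, hn]
    have hx' := simplexCone_mono (Finset.image_subset_image hV) hI hx
    have hx'' : x ∈ T.chart a '' F.1 := by rwa [T.image_cell F.1 F.2 a ha]
    obtain ⟨w, hw, hwx⟩ := hx''
    refine ⟨w, ⟨hw, by rwa [hwx]⟩, ?_⟩
    rw [hwx]
    simp [x, hi]

/-- A cell contained in another one is its face on the same vertices and directions. -/
lemma eq_cellFace (ha : F.1 ⊆ T.U a) {E : T.Cell} (hEF : E ≤ F) :
    E.1 = cellFace (T.chart a) F.1 (T.verts E) (T.dirs a E) := by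
  have hEF' : E.1 ⊆ F.1 := hEF
  obtain ⟨V, hV, hne, I, hI, h⟩ := T.inter_face F.1 F.2 E.1 E.2
    ⟨T.base E, hEF' (T.verts_subset E (T.base_mem E)), T.verts_subset E (T.base_mem E)⟩ a ha
  rw [Set.inter_eq_right.2 hEF'] at h
  rw [verts_of_eq_cellFace ha hV hI h, dirs_of_eq_cellFace ha hV hne hI h]
  exact h

lemma gens_mono {E : T.Cell} (hEF : E ≤ F) : T.gens a E ⊆ T.gens a F :=
  Finset.disjSum_mono (T.verts_mono hEF) (T.dirs_mono _ hEF)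

/-- Inside a common cell a face is recovered from its generators by `eq_cellFace`, so inclusion of
faces can be tested on finite sets. -/
lemma le_of_gens_subset (ha : F.1 ⊆ T.U a) {E E' : T.Cell} (hE : E ≤ F) (hE' : E' ≤ F)
    (h : T.gens a E ⊆ T.gens a E') : E ≤ E' := by
  have h1 : T.verts E ⊆ T.verts E' := fun v hv => inl_mem_gens.1 (h (inl_mem_gens.2 hv))
  have h2 : T.dirs a E ⊆ T.dirs a E' := fun i hi => inr_mem_gens.1 (h (inr_mem_gens.2 hi))
  change E.1 ⊆ E'.1
  rw [eq_cellFace ha hE, eq_cellFace ha hE']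
  exact fun x hx => ⟨hx.1, simplexCone_mono (Finset.image_subset_image h1) h2 hx.2⟩

lemma cellDim_lt {E : T.Cell} (h : E < F) : T.cellDim E < T.cellDim F := by
  have ha := T.subset_chartAt F
  have h1 := cellDim_add_one ha
  have h2 := cellDim_add_one (Set.Subset.trans h.le ha : E.1 ⊆ _)
  have h3 : T.gens (T.chartAt F) E ⊂ T.gens (T.chartAt F) F :=
    ⟨gens_mono h.le, fun h' => h.not_ge (le_of_gens_subset ha le_rfl h.le h')⟩
  have := Finset.card_lt_card h3
  omega

/-- A face obtained by deleting a vertex. -/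
lemma exists_facet {v : X} (hv : v ∈ T.verts F) (hne : ((T.verts F).erase v).Nonempty) :
    ∃ E : T.Cell, E < F ∧ T.verts E = (T.verts F).erase v := by
  have ha := T.subset_chartAt F
  have hV : (T.verts F).erase v ⊆ T.verts F := Finset.erase_subset _ _
  let E : T.Cell := ⟨_, T.face_mem F.1 F.2 _ ha _ hV hne _ (le_refl _)⟩
  have hE : T.verts E = (T.verts F).erase v := verts_of_eq_cellFace ha hV (le_refl _) rfl
  refine ⟨E, lt_of_le_of_ne (fun x hx => hx.1) ?_, hE⟩
  intro h
  rw [h] at hE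
  rw [hE] at hv
  exact Finset.notMem_erase _ _ hv

end Chart

end UnimodularComplex

/-- The successive differences of an increasing chain of finite sets exhaust the difference of its
ends. -/
lemma exists_list_of_chain {G R : Type*} [DecidableEq G] [Monoid R] {m : ℕ} (S : Fin (m + 1) → Finset G)
    (hS : Monotone S) :
    ∃ L : List G, L.Perm (S (Fin.last m) \ S 0).toList ∧ ∀ f : G → R,
      (List.ofFn fun i : Fin m => ((S i.succ \ S i.castSucc).toList.map f).prod).reverse.prod =
        (L.map f).prod := by
  induction m with
  | zero => exact ⟨[], by simp, fun f => by simp⟩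
  | succ m ih =>
    obtain ⟨L, hL, h⟩ := ih (fun i => S i.succ) (fun i j hij => hS (Fin.succ_le_succ_iff.2 hij))
    have h01 : S 0 ⊆ S 1 := hS (Fin.zero_le _)
    have h1m : S 1 ⊆ S (Fin.last (m + 1)) := hS (Fin.le_last _)
    -- Because of the reversal, the first difference of the chain is the rightmost block.
    refine ⟨L ++ (S 1 \ S 0).toList, ?_, fun f => ?_⟩
    · refine (hL.append_right _).trans ?_
      refine List.perm_of_nodup_nodup_toFinset_eq ?_ (Finset.nodup_toList _) ?_
      · refine List.Nodup.append (Finset.nodup_toList _) (Finset.nodup_toList _) ?_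
        intro g hg hg'
        rw [Finset.mem_toList, Finset.mem_sdiff] at hg hg'
        exact hg.2 hg'.1
      · ext g
        simp only [List.toFinset_append, Finset.toList_toFinset, Finset.mem_union,
          Finset.mem_sdiff, Fin.succ_last, Fin.succ_zero_eq_one]
        constructor
        · rintro (⟨h, h'⟩ | ⟨h, h'⟩)
          · exact ⟨h, fun h0 => h' (h01 h0)⟩
          · exact ⟨h1m h, h'⟩
        · rintro ⟨h, h'⟩
          by_cases hg : g ∈ S 1
          · exact Or.inr ⟨hg, h'⟩
          · exact Or.inl ⟨h, hg⟩
    · rw [List.ofFn_succ, List.reverse_cons, List.prod_append, List.map_append, List.prod_append,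
        ← h f, List.prod_singleton]
      rfl

/-- The sign of a flag has `-1` as its default value. It is multiplicative only because `P` and `Q`
agree up to sign and `Q ≠ 0`, so that exactly one of `P = Q` and `P = -Q` holds. -/
lemma ite_eq_mul_ite {V : Type*} [AddCommGroup V] [Module ℝ V] {P P' Q : V} {η : ℝ}
    (hη : η = 1 ∨ η = -1) (hP : P' = η • P) (h : P = Q ∨ P = -Q) (hQ : Q ≠ 0) :
    (if P' = Q then 1 else -1 : ℝ) = η * if P = Q then 1 else -1 := by
  have hneg : -Q ≠ Q := by
    intro h
    have h2 : (2 : ℝ) • Q = 0 := by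
      rw [two_smul]
      nth_rewrite 1 [← h]
      exact neg_add_cancel Q
    exact hQ ((smul_eq_zero.1 h2).resolve_left two_ne_zero)
  subst hP
  rcases hη with rfl | rfl <;> rcases h with rfl | rfl <;> simp [hneg]

/-! ### Volume elements and change of the base vertex -/

namespace UnimodularComplex

variable {X : Type*} [TopologicalSpace X] {T : UnimodularComplex X}

lemma vec_sub_vec {a : Fin T.numCharts} (p p' : X) (g : X ⊕ Fin (T.N a)) :
    T.vec a p g - T.vec a p' g = 0 ∨ T.vec a p g - T.vec a p' g = -T.vec a p' (Sum.inl p) := by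
  rcases g with v | i
  · right
    simp only [vec]
    abel
  · left
    exact sub_self _

/-- A change of base vertex shifts the vectors to vertices by a common generator and fixes the
divisorial ones. Coefficients are kept in `ℤ` so that volume elements are compared up to sign and
not only up to a scalar. -/
lemma vec_mem_span_int {a : Fin T.numCharts} {S : Finset (X ⊕ Fin (T.N a))} {p p' : X}
    (hp : Sum.inl p ∈ S) {L : List (X ⊕ Fin (T.N a))}
    (hL : L.Perm (S.erase (Sum.inl p')).toList) {g : X ⊕ Fin (T.N a)} (hg : g ∈ S) :
    T.vec a p g ∈ Submodule.span ℤ {y | y ∈ L.map (T.vec a p')} := by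
  have key : ∀ g ∈ S, T.vec a p' g ∈ Submodule.span ℤ {y | y ∈ L.map (T.vec a p')} := by
    intro g hg
    by_cases h : g = Sum.inl p'
    · rw [h, vec_self]
      exact Submodule.zero_mem _
    · exact Submodule.subset_span (List.mem_map.2
        ⟨g, hL.mem_iff.2 (Finset.mem_toList.2 (Finset.mem_erase.2 ⟨h, hg⟩)), rfl⟩)
  rw [← sub_add_cancel (T.vec a p g) (T.vec a p' g)]
  refine Submodule.add_mem _ ?_ (key g hg)
  rcases vec_sub_vec p p' g with h | h <;> rw [h]
  · exact Submodule.zero_mem _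
  · exact Submodule.neg_mem _ (key _ hp)

/-- The volume elements of a cell obtained from two base points and two orders of the remaining
generators agree up to sign. -/
lemma prod_gens_eq_or_neg {a : Fin T.numCharts} {S : Finset (X ⊕ Fin (T.N a))} {p p' : X}
    (hp : Sum.inl p ∈ S) (hp' : Sum.inl p' ∈ S) {L L' : List (X ⊕ Fin (T.N a))}
    (hL : L.Perm (S.erase (Sum.inl p)).toList) (hL' : L'.Perm (S.erase (Sum.inl p')).toList) :
    (L.map fun g => ExteriorAlgebra.ι ℝ (T.vec a p g)).prod =
        (L'.map fun g => ExteriorAlgebra.ι ℝ (T.vec a p' g)).prod ∨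
      (L.map fun g => ExteriorAlgebra.ι ℝ (T.vec a p g)).prod =
        -(L'.map fun g => ExteriorAlgebra.ι ℝ (T.vec a p' g)).prod := by
  have key := prod_map_ι_eq_or_neg (L := L.map (T.vec a p)) (L' := L'.map (T.vec a p'))
    (by rw [List.length_map, List.length_map, hL.length_eq, hL'.length_eq, Finset.length_toList,
          Finset.length_toList, Finset.card_erase_of_mem hp, Finset.card_erase_of_mem hp'])
    (by
      intro x hx
      obtain ⟨g, hg, rfl⟩ := List.mem_map.1 hx
      exact vec_mem_span_int hp hL'
        (Finset.mem_of_mem_erase (Finset.mem_toList.1 (hL.mem_iff.1 hg))))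
    (by
      intro x hx
      obtain ⟨g, hg, rfl⟩ := List.mem_map.1 hx
      exact vec_mem_span_int hp' hL
        (Finset.mem_of_mem_erase (Finset.mem_toList.1 (hL'.mem_iff.1 hg))))
  rw [List.map_map, List.map_map] at key
  exact key

lemma vec_sub_vec_mem {a : Fin T.numCharts} {K : Submodule ℝ (Fin (T.N a) → ℝ)} {p p' : X}
    (h : T.pt a p - T.pt a p' ∈ K) (g : X ⊕ Fin (T.N a)) : T.vec a p g - T.vec a p' g ∈ K := by
  rcases vec_sub_vec p p' g with h' | h' <;> rw [h']
  · exact Submodule.zero_mem _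
  · exact Submodule.neg_mem _ h

/-- The list of vectors whose product is `simplexVol`. -/
def simplexVecs (T : UnimodularComplex X) (a : Fin T.numCharts) (E : T.Cell) :
    List (Fin (T.N a) → ℝ) :=
  ((T.gens a E).erase (Sum.inl (T.base E))).toList.map (T.vec a (T.base E))

lemma simplexVol_eq (a : Fin T.numCharts) (E : T.Cell) :
    T.simplexVol a E = ((T.simplexVecs a E).map (ExteriorAlgebra.ι ℝ)).prod := by
  rw [simplexVecs, List.map_map]
  rfl

lemma vec_mem_span_simplexVecs {a : Fin T.numCharts} {E : T.Cell} {p : X} (hp : p ∈ T.verts E)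
    {g : X ⊕ Fin (T.N a)} (hg : g ∈ T.gens a E) :
    T.vec a p g ∈ Submodule.span ℝ {y | y ∈ T.simplexVecs a E} := by
  have := vec_mem_span_int (p := p) (p' := T.base E) (inl_mem_gens.2 hp) (List.Perm.refl _) hg
  exact (Submodule.span_le_restrictScalars ℤ ℝ _) this

/-- Changing the base point of the complementary factor of a volume element. -/
lemma simplexVol_mul_relVol {a : Fin T.numCharts} {E : T.Cell} {p p' : X} (hp : p ∈ T.verts E)
    (hp' : p' ∈ T.verts E) (D F : T.Cell) :
    T.simplexVol a E * T.relVol a p D F = T.simplexVol a E * T.relVol a p' D F := by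
  rw [simplexVol_eq]
  exact mul_prod_map_congr_right _ _ _ _ fun g _ =>
    vec_sub_vec_mem (vec_mem_span_simplexVecs hp' (inl_mem_gens.2 hp)) g

/-! ### Signs of flags -/

section Sign

variable {a : Fin T.numCharts} {k : ℕ} (Δ : T.OrientedSimplex k)

/-- The list of vectors whose product is the volume element of an oriented simplex. -/
def OrientedSimplex.vecs (a : Fin T.numCharts) : List (Fin (T.N a) → ℝ) :=
  List.ofFn fun i : Fin k => T.pt a (Δ.vert i.succ) - T.pt a (Δ.vert 0)

lemma OrientedSimplex.vol_eq (a : Fin T.numCharts) :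
    Δ.vol a = ((Δ.vecs a).map (ExteriorAlgebra.ι ℝ)).prod := by
  rw [vol, ExteriorAlgebra.ιMulti_apply, vecs, List.map_ofFn]
  rfl

lemma OrientedSimplex.vert_mem (i : Fin (k + 1)) : Δ.vert i ∈ T.verts Δ.cell := by
  rw [← Δ.range_vert]
  exact Finset.mem_image.2 ⟨i, Finset.mem_univ _, rfl⟩

lemma OrientedSimplex.sub_mem_span_vecs {p p' : X} (hp : p ∈ T.verts Δ.cell)
    (hp' : p' ∈ T.verts Δ.cell) :
    T.pt a p - T.pt a p' ∈ Submodule.span ℝ {y | y ∈ Δ.vecs a} := by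
  have key : ∀ p ∈ T.verts Δ.cell,
      T.pt a p - T.pt a (Δ.vert 0) ∈ Submodule.span ℝ {y | y ∈ Δ.vecs a} := by
    intro p hp
    rw [← Δ.range_vert, Finset.mem_image] at hp
    obtain ⟨i, -, rfl⟩ := hp
    refine Fin.cases ?_ (fun i => ?_) i
    · rw [sub_self]
      exact Submodule.zero_mem _
    · exact Submodule.subset_span (List.mem_ofFn.2 ⟨i, rfl⟩)
  simpa using Submodule.sub_mem _ (key p hp) (key p' hp')

lemma OrientedSimplex.vol_mul_relVol {p p' : X} (hp : p ∈ T.verts Δ.cell)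
    (hp' : p' ∈ T.verts Δ.cell) (D F : T.Cell) :
    Δ.vol a * T.relVol a p D F = Δ.vol a * T.relVol a p' D F := by
  rw [Δ.vol_eq]
  exact mul_prod_map_congr_right _ _ _ _ fun g _ =>
    vec_sub_vec_mem (Δ.sub_mem_span_vecs hp hp') g

lemma OrientedSimplex.gens_eq (ha : Δ.cell.1 ⊆ T.U a) :
    T.gens a Δ.cell = (Finset.univ.image Δ.vert).disjSum ∅ := by
  rw [gens, T.dirs_eq_empty Δ.isFinite le_rfl a ha, Δ.range_vert]

lemma OrientedSimplex.cellDim_eq : T.cellDim Δ.cell = k := by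
  have h := cellDim_add_one (T.subset_chartAt Δ.cell)
  rw [Δ.gens_eq (T.subset_chartAt Δ.cell), Finset.card_disjSum,
    Finset.card_image_of_injective _ Δ.injective] at h
  simpa using h

/-- The generators of `F` other than the first vertex of `Δ`, first those of `Δ` in order. -/
def OrientedSimplex.genList (a : Fin T.numCharts) (F : T.Cell) : List (X ⊕ Fin (T.N a)) :=
  (List.ofFn fun i : Fin k => Sum.inl (Δ.vert i.succ)) ++
    (T.gens a F \ T.gens a Δ.cell).toList

lemma OrientedSimplex.genList_perm {F : T.Cell} (ha : F.1 ⊆ T.U a) (hF : Δ.cell ≤ F) :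
    (Δ.genList a F).Perm ((T.gens a F).erase (Sum.inl (Δ.vert 0))).toList := by
  have hΔ := Δ.gens_eq (Set.Subset.trans hF ha)
  refine List.perm_of_nodup_nodup_toFinset_eq ?_ (Finset.nodup_toList _) ?_
  · refine List.Nodup.append ?_ (Finset.nodup_toList _) ?_
    · exact List.nodup_ofFn.2 fun i j h => Fin.succ_injective _ (Δ.injective (Sum.inl.inj h))
    · intro g hg hg'
      obtain ⟨i, rfl⟩ := List.mem_ofFn.1 hg
      rw [Finset.mem_toList, Finset.mem_sdiff, inl_mem_gens (F := Δ.cell)] at hg'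
      exact hg'.2 (Δ.vert_mem _)
  · ext g
    simp only [genList, List.toFinset_append, Finset.toList_toFinset, Finset.mem_union,
      Finset.mem_sdiff, List.mem_toFinset, List.mem_ofFn, Finset.mem_erase]
    constructor
    · rintro (⟨i, rfl⟩ | ⟨h, h'⟩)
      · refine ⟨fun h => ?_, inl_mem_gens.2 (T.verts_mono hF (Δ.vert_mem _))⟩
        exact Fin.succ_ne_zero _ (Δ.injective (Sum.inl.inj h))
      · refine ⟨?_, h⟩
        rintro rfl
        exact h' (inl_mem_gens.2 (Δ.vert_mem _))
    · rintro ⟨h, h'⟩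
      by_cases hg : g ∈ T.gens a Δ.cell
      · left
        rw [hΔ] at hg
        rcases g with v | i
        · simp only [Finset.inl_mem_disjSum, Finset.mem_image, Finset.mem_univ, true_and] at hg
          obtain ⟨i, rfl⟩ := hg
          obtain ⟨j, rfl⟩ := Fin.exists_succ_eq.2 (fun h0 => h (by rw [h0]) : i ≠ 0)
          exact ⟨j, rfl⟩
        · simp at hg
      · exact Or.inr ⟨h', hg⟩

lemma OrientedSimplex.vol_mul_relVol_eq {p : X} (hp : p ∈ T.verts Δ.cell) (F : T.Cell) :
    Δ.vol a * T.relVol a p Δ.cell F =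
      ((Δ.genList a F).map fun g => ExteriorAlgebra.ι ℝ (T.vec a (Δ.vert 0) g)).prod := by
  rw [Δ.vol_mul_relVol hp (Δ.vert_mem 0), genList, List.map_append, List.prod_append,
    List.map_ofFn, vol, ExteriorAlgebra.ιMulti_apply]
  rfl

lemma OrientedSimplex.vol_mul_relVol_ne_zero {F : T.Cell} (ha : F.1 ⊆ T.U a) (hF : Δ.cell ≤ F)
    {p : X} (hp : p ∈ T.verts Δ.cell) : Δ.vol a * T.relVol a p Δ.cell F ≠ 0 := by
  rw [Δ.vol_mul_relVol_eq hp]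
  have hperm := Δ.genList_perm ha hF
  refine prod_map_ι_ne_zero (hperm.nodup_iff.2 (Finset.nodup_toList _)) ?_
  have hli := linearIndepOn_vec ha (T.verts_mono hF (Δ.vert_mem 0))
  exact hli.mono (t := {g | g ∈ Δ.genList a F}) fun g hg =>
    Finset.mem_coe.2 (Finset.mem_toList.1 (hperm.mem_iff.1 hg))

/-- The volume element `u_m ∧ ⋯ ∧ u_1 ∧ Vol_{σ₀}` given by a flag. -/
def flagVol (T : UnimodularComplex X) (a : Fin T.numCharts) {m : ℕ} (σ : T.BarSimplex m) :
    T.Ext a :=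
  (List.ofFn fun i : Fin m =>
    T.relVol a (T.base (σ 0)) (σ i.castSucc) (σ i.succ)).reverse.prod * T.simplexVol a (σ 0)

/-- The order `L` does not depend on `p`, which lets `flagVol_tail` compare two base vertices factor
by factor. -/
lemma exists_list_of_flag (a : Fin T.numCharts) {m : ℕ} (σ : T.BarSimplex m) :
    ∃ L : List (X ⊕ Fin (T.N a)), L.Perm (T.gens a (σ (Fin.last m)) \ T.gens a (σ 0)).toList ∧
      ∀ p, (List.ofFn fun i : Fin m => T.relVol a p (σ i.castSucc) (σ i.succ)).reverse.prod =
        (L.map fun g => ExteriorAlgebra.ι ℝ (T.vec a p g)).prod := by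
  obtain ⟨L, hL, h⟩ := exists_list_of_chain (R := T.Ext a) (fun i => T.gens a (σ i))
    (fun i j hij => gens_mono (σ.monotone hij))
  exact ⟨L, hL, fun p => h _⟩

/-- Both sides are products over all generators of `σ_m` except one vertex, taken from that vertex,
so `prod_gens_eq_or_neg` applies. -/
lemma flagVol_eq_or_neg {m : ℕ} {σ : T.BarSimplex m} (ha : (σ (Fin.last m)).1 ⊆ T.U a)
    (h0 : σ 0 ≤ Δ.cell) (h1 : Δ.cell ≤ σ (Fin.last m)) :
    T.flagVol a σ = Δ.vol a * T.relVol a (T.base (σ 0)) Δ.cell (σ (Fin.last m)) ∨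
      T.flagVol a σ = -(Δ.vol a * T.relVol a (T.base (σ 0)) Δ.cell (σ (Fin.last m))) := by
  obtain ⟨L, hL, h⟩ := exists_list_of_flag a σ
  have hb := T.base_mem (σ 0)
  rw [Δ.vol_mul_relVol_eq (T.verts_mono h0 hb)]
  have hP : T.flagVol a σ = ((L ++ ((T.gens a (σ 0)).erase (Sum.inl (T.base (σ 0)))).toList).map
      fun g => ExteriorAlgebra.ι ℝ (T.vec a (T.base (σ 0)) g)).prod := by
    rw [flagVol, h, List.map_append, List.prod_append]
    rfl
  rw [hP]
  refine prod_gens_eq_or_neg (S := T.gens a (σ (Fin.last m)))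
    (inl_mem_gens.2 (T.verts_mono (h0.trans h1) hb))
    (inl_mem_gens.2 (T.verts_mono h1 (Δ.vert_mem 0))) ?_ (Δ.genList_perm ha h1)
  refine (hL.append_right _).trans ?_
  refine List.perm_of_nodup_nodup_toFinset_eq ?_ (Finset.nodup_toList _) ?_
  · refine List.Nodup.append (Finset.nodup_toList _) (Finset.nodup_toList _) ?_
    intro g hg hg'
    rw [Finset.mem_toList] at hg hg'
    exact (Finset.mem_sdiff.1 hg).2 (Finset.mem_of_mem_erase hg')
  · ext g
    have hsub := gens_mono (a := a) (h0.trans h1)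
    simp only [List.toFinset_append, Finset.toList_toFinset, Finset.mem_union,
      Finset.mem_sdiff, Finset.mem_erase]
    constructor
    · rintro (⟨h, h'⟩ | ⟨h, h'⟩)
      · refine ⟨?_, h⟩
        rintro rfl
        exact h' (inl_mem_gens.2 hb)
      · exact ⟨h, hsub h'⟩
    · rintro ⟨h, h'⟩
      by_cases hg : g ∈ T.gens a (σ 0)
      · exact Or.inr ⟨h, hg⟩
      · exact Or.inl ⟨h', hg⟩

/-- The vector from a facet to the opposite vertex, times a volume element of the facet, is a
volume element. -/
lemma ι_mul_simplexVol {E F : T.Cell} {v : X} (hEF : E ≤ F)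
    (hg : T.gens a F \ T.gens a E = {Sum.inl v}) :
    ∃ η : ℝ, (η = 1 ∨ η = -1) ∧
      ExteriorAlgebra.ι ℝ (T.vec a (T.base E) (Sum.inl v)) * T.simplexVol a E =
        η • T.simplexVol a F := by
  have hb := T.base_mem E
  have h := prod_gens_eq_or_neg (a := a) (S := T.gens a F) (p := T.base E) (p' := T.base F)
    (L := Sum.inl v :: ((T.gens a E).erase (Sum.inl (T.base E))).toList)
    (L' := ((T.gens a F).erase (Sum.inl (T.base F))).toList)
    (inl_mem_gens.2 (T.verts_mono hEF hb)) (inl_mem_gens.2 (T.base_mem F)) ?_ (List.Perm.refl _)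
  · rw [List.map_cons, List.prod_cons] at h
    rcases h with h | h
    · exact ⟨1, Or.inl rfl, by rw [one_smul]; exact h⟩
    · exact ⟨-1, Or.inr rfl, by rw [neg_one_smul]; exact h⟩
  · have hv : Sum.inl v ∈ T.gens a F \ T.gens a E := by rw [hg]; exact Finset.mem_singleton_self _
    have hmem : ∀ g, g ∈ T.gens a F ↔ g = Sum.inl v ∨ g ∈ T.gens a E := by
      intro g
      rw [← Finset.mem_singleton, ← hg, Finset.mem_sdiff]
      have := @gens_mono _ _ T a F E hEF g
      tauto
    refine List.perm_of_nodup_nodup_toFinset_eq ?_ (Finset.nodup_toList _) ?_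
    · refine List.nodup_cons.2 ⟨fun h => ?_, Finset.nodup_toList _⟩
      exact (Finset.mem_sdiff.1 hv).2 (Finset.mem_of_mem_erase (Finset.mem_toList.1 h))
    · ext g
      simp only [List.toFinset_cons, Finset.toList_toFinset, Finset.mem_insert, Finset.mem_erase,
        hmem]
      constructor
      · rintro (rfl | ⟨h, h'⟩)
        · refine ⟨fun h => ?_, Or.inl rfl⟩
          rw [h] at hv
          exact (Finset.mem_sdiff.1 hv).2 (inl_mem_gens.2 hb)
        · exact ⟨h, Or.inr h'⟩
      · rintro ⟨h, rfl | h'⟩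
        · exact Or.inl rfl
        · exact Or.inr ⟨h, h'⟩

/-- The first step `u_1` of the flag stands next to `Vol_{σ₀}`, and together they form `η Vol_{σ₁}`.
This factor then absorbs the change of base vertex in `u_m, …, u_2`. -/
lemma flagVol_tail {m : ℕ} {σ : T.BarSimplex (m + 1)} {v : X}
    (hg : T.gens a (T.tail σ 0) \ T.gens a (σ 0) = {Sum.inl v}) {η : ℝ}
    (h : ExteriorAlgebra.ι ℝ (T.vec a (T.base (σ 0)) (Sum.inl v)) * T.simplexVol a (σ 0) =
        η • T.simplexVol a (T.tail σ 0)) :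
    T.flagVol a σ = η • T.flagVol a (T.tail σ) := by
  obtain ⟨L, -, hL⟩ := exists_list_of_flag a (T.tail σ)
  have h01 : σ 0 ≤ T.tail σ 0 := σ.monotone (Fin.zero_le _)
  have hrel : T.relVol a (T.base (σ 0)) (σ 0) (T.tail σ 0) =
      ExteriorAlgebra.ι ℝ (T.vec a (T.base (σ 0)) (Sum.inl v)) := by
    rw [relVol, hg, wedgeSet, Finset.toList_singleton, List.map_singleton, List.prod_singleton]
  have h1 : T.flagVol a σ = (List.ofFn fun i : Fin m => T.relVol a (T.base (σ 0))
      (T.tail σ i.castSucc) (T.tail σ i.succ)).reverse.prod *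
      (T.relVol a (T.base (σ 0)) (σ 0) (T.tail σ 0) * T.simplexVol a (σ 0)) := by
    rw [flagVol, List.ofFn_succ, List.reverse_cons, List.prod_append, List.prod_singleton,
      mul_assoc]
    rfl
  rw [h1, hrel, h, hL, flagVol, hL, mul_smul_comm, simplexVol_eq]
  congr 1
  exact prod_map_mul_congr_left _ _ _ _ fun g _ => vec_sub_vec_mem
    (vec_mem_span_simplexVecs (T.base_mem _) (inl_mem_gens.2 (T.verts_mono h01 (T.base_mem _)))) g

lemma dualSign_eq {m : ℕ} (σ : T.BarSimplex m) :
    T.dualSign Δ σ = if T.flagVol (T.chartAt (σ (Fin.last m))) σ =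
        Δ.vol _ * T.relVol _ (T.base (σ 0)) Δ.cell (σ (Fin.last m)) then 1 else -1 := rfl

lemma dualSign_tail {m : ℕ} {σ : T.BarSimplex (m + 1)} (h0 : T.tail σ 0 ≤ Δ.cell)
    (h1 : Δ.cell ≤ σ (Fin.last (m + 1))) {v : X}
    (hg : T.gens (T.chartAt (σ (Fin.last (m + 1)))) (T.tail σ 0) \ T.gens _ (σ 0) = {Sum.inl v})
    {η : ℝ} (hη : η = 1 ∨ η = -1)
    (h : ExteriorAlgebra.ι ℝ (T.vec (T.chartAt (σ (Fin.last (m + 1)))) (T.base (σ 0)) (Sum.inl v)) *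
      T.simplexVol _ (σ 0) = η • T.simplexVol _ (T.tail σ 0)) :
    T.dualSign Δ σ = η * T.dualSign Δ (T.tail σ) := by
  have h01 : σ 0 ≤ T.tail σ 0 := σ.monotone (Fin.zero_le _)
  have ha := T.subset_chartAt (σ (Fin.last (m + 1)))
  have hb := T.verts_mono h0 (T.base_mem (T.tail σ 0))
  have hP := flagVol_tail hg h
  have hs := flagVol_eq_or_neg (σ := T.tail σ) Δ ha h0 h1
  have hQ := Δ.vol_mul_relVol (a := T.chartAt (σ (Fin.last (m + 1))))
    (T.verts_mono (h01.trans h0) (T.base_mem (σ 0))) hb Δ.cell (σ (Fin.last (m + 1)))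
  have hQ0 := Δ.vol_mul_relVol_ne_zero ha h1 hb
  rw [dualSign_eq, hQ]
  exact ite_eq_mul_ite hη hP hs hQ0

end Sign

end UnimodularComplex

/-! ### Flags, facets and barycentric coordinates -/

namespace UnimodularComplex

variable {X : Type*} [TopologicalSpace X] {T : UnimodularComplex X}

lemma killDirs_empty {N : ℕ} (v : Fin N → ℝ) : killDirs ∅ v = v := by
  ext i
  simp [killDirs]

lemma cellDim_add_le : ∀ {m : ℕ} (σ : T.BarSimplex m),
    T.cellDim (σ 0) + m ≤ T.cellDim (σ (Fin.last m))
  | 0, _ => le_rfl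
  | m + 1, σ => by
    have h := cellDim_add_le (T.tail σ)
    have h01 : T.cellDim (σ 0) < T.cellDim (T.tail σ 0) := cellDim_lt (σ.strictMono (Fin.succ_pos 0))
    have h' : T.cellDim (T.tail σ (Fin.last m)) = T.cellDim (σ (Fin.last (m + 1))) := rfl
    omega

lemma exists_flag_cons {m : ℕ} {τ : T.BarSimplex m} {E : T.Cell} (hE : E < τ 0) :
    ∃ σ : T.BarSimplex (m + 1), T.tail σ = τ ∧ σ 0 = E := by
  have hmono : StrictMono (Fin.cons E τ : Fin (m + 2) → T.Cell) := by
    rw [Fin.strictMono_iff_lt_succ]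
    intro i
    refine Fin.cases ?_ (fun j => ?_) i
    · exact hE.trans_le (τ.monotone (Fin.zero_le _))
    · rw [← Fin.succ_castSucc, Fin.cons_succ, Fin.cons_succ]
      exact τ.strictMono Fin.castSucc_lt_succ
  exact ⟨OrderEmbedding.ofStrictMono _ hmono, rfl, rfl⟩

lemma flag_ext {m : ℕ} {σ σ' : T.BarSimplex (m + 1)} (h : T.tail σ = T.tail σ')
    (h0 : σ 0 = σ' 0) : σ = σ' := by
  ext1 i
  refine Fin.cases h0 (fun i => ?_) i
  exact DFunLike.congr_fun h i

/-- The generators of a cell that are not in a facet. -/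
lemma exists_gens_sdiff {a : Fin T.numCharts} {E F : T.Cell} (ha : F.1 ⊆ T.U a) (hEF : E ≤ F)
    (hdim : T.cellDim F = T.cellDim E + 1) : ∃ g, T.gens a F \ T.gens a E = {g} := by
  rw [← Finset.card_eq_one, Finset.card_sdiff_of_subset (gens_mono hEF)]
  have h1 := cellDim_add_one ha
  have h2 := cellDim_add_one (Set.Subset.trans hEF ha : E.1 ⊆ _)
  omega

lemma gens_eq_of_dirs {a : Fin T.numCharts} {F : T.Cell} (h : T.dirs a F = ∅) :
    T.gens a F = (T.verts F).disjSum ∅ := by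
  rw [gens, h]

lemma gens_sdiff_of_verts {a : Fin T.numCharts} {E F : T.Cell} {v : X} (hv : v ∈ T.verts F)
    (hEF : T.verts E = (T.verts F).erase v) (hF : T.dirs a F = ∅) (hE : T.dirs a E = ∅) :
    T.gens a F \ T.gens a E = {Sum.inl v} := by
  ext g
  rw [gens_eq_of_dirs hF, gens_eq_of_dirs hE, hEF]
  rcases g with w | i
  · simp only [Finset.mem_sdiff, Finset.inl_mem_disjSum, Finset.mem_erase, Finset.mem_singleton,
      Sum.inl.injEq]
    constructor
    · rintro ⟨h1, h2⟩
      by_contra h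
      exact h2 ⟨h, h1⟩
    · rintro rfl
      exact ⟨hv, fun h => h.1 rfl⟩
  · simp

lemma exists_barycentric_coords {a : Fin T.numCharts} {F : T.Cell} (ha : F.1 ⊆ T.U a)
    (hd : T.dirs a F = ∅) {x : X} (hx : x ∈ F.1) (hm : IsMobile (T.chart a x)) :
    ∃ t : X → ℝ, ∑ v ∈ T.verts F, t v = 1 ∧ T.pt a x = ∑ v ∈ T.verts F, t v • T.pt a v := by
  have hc : T.chart a x ∈ T.chart a '' F.1 := ⟨x, hx, rfl⟩
  rw [T.image_cell F.1 F.2 a ha] at hc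
  obtain ⟨t, c, ht, h⟩ := exists_coords_of_mem_simplexCone (f := T.pt a)
    (injOn_pt_verts ha) hm hc
  have hd' : divIndex (T.chart a) F.1 = ∅ := hd
  rw [hd', Finset.sum_empty, add_zero] at h
  exact ⟨t, ht, h⟩

/-- The vector between points of a simplex and of a facet, wedged with a volume element of the
facet, is the barycentric coordinate at the opposite vertex times a volume element. -/
lemma ι_sub_mul_simplexVol {a : Fin T.numCharts} {E F : T.Cell} {v x x' : X} (hv : v ∈ T.verts F)
    (hEF : T.verts E = (T.verts F).erase v) {t s : X → ℝ} (ht : ∑ w ∈ T.verts F, t w = 1)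
    (hx : T.pt a x = ∑ w ∈ T.verts F, t w • T.pt a w) (hs : ∑ w ∈ T.verts E, s w = 1)
    (hx' : T.pt a x' = ∑ w ∈ T.verts E, s w • T.pt a w) :
    ExteriorAlgebra.ι ℝ (T.pt a x - T.pt a x') * T.simplexVol a E =
      t v • (ExteriorAlgebra.ι ℝ (T.vec a (T.base E) (Sum.inl v)) * T.simplexVol a E) := by
  rw [← smul_mul_assoc, ← map_smul, ← sub_eq_zero, ← sub_mul, ← map_sub, simplexVol_eq]
  apply ι_mul_prod_map_ι_eq_zero
  rw [← Finset.add_sum_erase _ _ hv, ← hEF] at ht hx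
  -- Since `t` and `s` both have sum one, the weights `t w - s w` over the facet have sum `-t v`,
  -- which accounts for the base vertex in `t v • (v - p)`.
  have key : T.pt a x - T.pt a x' - t v • T.vec a (T.base E) (Sum.inl v) =
      ∑ w ∈ T.verts E, (t w - s w) • T.vec a (T.base E) (Sum.inl w) := by
    simp only [vec, smul_sub, sub_smul, Finset.sum_sub_distrib, ← Finset.sum_smul]
    rw [hs, eq_sub_of_add_eq' ht, hx, hx', sub_smul, one_smul]
    abel
  rw [key]
  exact Submodule.sum_mem _ fun w hw => Submodule.smul_mem _ _
    (vec_mem_span_simplexVecs (T.base_mem E) (inl_mem_gens.2 hw))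

/-! ### The cap product with konstruktor chains -/

section Cap

variable {ψ : T.WaveCochain}

lemma capTerm_val {p q : ℕ} (γ : T.Chain p (q + 1)) (σ : T.BarSimplex (q + 1))
    (hd : T.dirs (T.chartAt (σ (Fin.last (q + 1)))) (σ 0) = ∅)
    (h01 : σ 0 < T.tail σ 0) (hU : (T.tail σ 0).1 ⊆ T.U (T.chartAt (σ (Fin.last (q + 1))))) :
    @Eq (T.Ext (T.chartAt (σ (Fin.last (q + 1))))) (T.capTerm ψ γ σ).1
      (ExteriorAlgebra.map (killDirs (T.dirs (T.chartAt (σ (Fin.last (q + 1)))) (T.tail σ 0)))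
        (ExteriorAlgebra.ι ℝ (ψ.val (σ 0) (T.tail σ 0) h01 _ hU) * (γ σ).1)) := by
  have h : @Eq (T.Ext (T.chartAt (σ (Fin.last (q + 1))))) (T.capTerm ψ γ σ).1
      (ExteriorAlgebra.map (killDirs (T.dirs (T.chartAt (σ (Fin.last (q + 1)))) (T.tail σ 0)))
        (ExteriorAlgebra.ι ℝ (killDirs (T.dirs (T.chartAt (σ (Fin.last (q + 1)))) (σ 0))
          (ψ.val (σ 0) (T.tail σ 0) h01 _ hU)) * (γ σ).1)) := rfl
  rw [hd, killDirs_empty] at h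
  exact h

lemma capTerm_eq_zero {p q : ℕ} {γ : T.Chain p (q + 1)} {σ : T.BarSimplex (q + 1)}
    (h : γ σ = 0) : T.capTerm ψ γ σ = 0 := by
  exact (congrArg _ h).trans (map_zero _)

variable {k l : ℕ} {Δ : T.OrientedSimplex k} {c : T.propellers Δ.cell l} {r m : ℕ}

lemma twist_val {hm : m + r = k + l} {σ : T.BarSimplex m}
    (h : (σ 0 ≤ Δ.cell ∧ T.cellDim (σ 0) = r) ∧ (Δ.cell ≤ σ (Fin.last m) ∧
      T.cellDim (σ (Fin.last m)) = T.cellDim Δ.cell + l)) :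
    (T.twist Δ c r m hm σ).1 =
      (((c.1 ⟨σ (Fin.last m), h.2⟩ : ℚ) : ℝ) * T.dualSign Δ σ) • T.faceVol Δ σ := by
  rw [twist, dif_pos h]
  rfl

/-- The flag rises from dimension `r` to `k + l` in `m + 1 = k + l - r` strict steps, so each step
raises the dimension by exactly one. -/
lemma cellDim_tail {hm : (m + 1) + r = k + l} {σ : T.BarSimplex (m + 1)}
    (h : (σ 0 ≤ Δ.cell ∧ T.cellDim (σ 0) = r) ∧ (Δ.cell ≤ σ (Fin.last (m + 1)) ∧
      T.cellDim (σ (Fin.last (m + 1))) = T.cellDim Δ.cell + l)) :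
    T.cellDim (T.tail σ 0) = r + 1 := by
  have h1 := cellDim_add_le (T.tail σ)
  have h01 : T.cellDim (σ 0) < T.cellDim (T.tail σ 0) := cellDim_lt (σ.strictMono (Fin.succ_pos 0))
  have h' : T.cellDim (T.tail σ (Fin.last m)) = T.cellDim (σ (Fin.last (m + 1))) := rfl
  have h2 := h.1.2
  have h3 := h.2.2
  rw [Δ.cellDim_eq] at h3
  omega

/-- Flags that leave `Δ` immediately do not contribute to the cap product. -/
lemma capTerm_twist_eq_zero {hm : (m + 1) + r = k + l} {σ : T.BarSimplex (m + 1)}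
    (h : ¬ T.tail σ 0 ≤ Δ.cell) : T.capTerm ψ (T.twist Δ c r (m + 1) hm) σ = 0 := by
  by_cases hσ : (σ 0 ≤ Δ.cell ∧ T.cellDim (σ 0) = r) ∧ (Δ.cell ≤ σ (Fin.last (m + 1)) ∧
      T.cellDim (σ (Fin.last (m + 1))) = T.cellDim Δ.cell + l)
  swap
  · exact capTerm_eq_zero (dif_neg hσ)
  have hdim := cellDim_tail (hm := hm) hσ
  obtain ⟨⟨h0, hr⟩, h1, -⟩ := id hσ
  have ha := T.subset_chartAt (σ (Fin.last (m + 1)))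
  have h01 : σ 0 < T.tail σ 0 := σ.strictMono (Fin.succ_pos 0)
  have h1m : T.tail σ 0 ≤ σ (Fin.last (m + 1)) := σ.monotone (Fin.le_last _)
  have hU := Set.Subset.trans h1m ha
  apply Subtype.ext
  refine (capTerm_val _ _ (T.dirs_eq_empty Δ.isFinite h0 _ (Set.Subset.trans h01.le hU))
    h01 hU).trans ?_
  rw [twist_val hσ, mul_smul_comm, map_smul]
  obtain ⟨g, hg⟩ := exists_gens_sdiff hU h01.le (by rw [hdim, hr])
  -- The product vanishes already before the projection along divisorial directions.
  suffices hz : ExteriorAlgebra.ι ℝ (ψ.val (σ 0) (T.tail σ 0) h01 _ hU) * T.faceVol Δ σ = 0 by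
    exact smul_eq_zero_of_right _ ((congrArg _ hz).trans (map_zero _))
  let K := T.simplexVecs (T.chartAt (σ (Fin.last (m + 1)))) (σ 0) ++
    (T.gens (T.chartAt (σ (Fin.last (m + 1)))) (σ (Fin.last (m + 1))) \
      T.gens (T.chartAt (σ (Fin.last (m + 1)))) Δ.cell).toList.map (T.vec _ (T.base (σ 0)))
  have hK : T.faceVol Δ σ = (K.map (ExteriorAlgebra.ι ℝ)).prod := by
    rw [faceVol, simplexVol_eq, List.map_append, List.prod_append, List.map_map]
    rfl
  rw [hK]
  apply ι_mul_prod_map_ι_eq_zero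
  have hmem := ψ.mem (σ 0) (T.tail σ 0) h01 _ hU
  rw [lin_eq_span hU (T.verts_mono h01.le (T.base_mem _))] at hmem
  refine Submodule.span_le.2 ?_ hmem
  rintro _ ⟨g', hg', rfl⟩
  by_cases hgF : g' ∈ T.gens (T.chartAt (σ (Fin.last (m + 1)))) (σ 0)
  · refine Submodule.span_mono ?_ (vec_mem_span_simplexVecs (T.base_mem _) hgF)
    exact fun y hy => List.mem_append_left _ hy
  · have hgg : g' ∈ T.gens (T.chartAt (σ (Fin.last (m + 1)))) (T.tail σ 0) \ T.gens _ (σ 0) :=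
      Finset.mem_sdiff.2 ⟨hg', hgF⟩
    apply Submodule.subset_span
    refine List.mem_append_right _ (List.mem_map.2 ⟨g', Finset.mem_toList.2
      (Finset.mem_sdiff.2 ⟨gens_mono h1m hg', fun hgΔ => h ?_⟩), rfl⟩)
    -- `g'` is the only generator that `σ₁` adds to `σ₀`; if it belonged to `Δ`, all of `σ₁` would
    -- lie in `Δ`.
    refine le_of_gens_subset ha h1m h1 fun g'' hg'' => ?_
    by_cases hg0 : g'' ∈ T.gens (T.chartAt (σ (Fin.last (m + 1)))) (σ 0)
    · exact gens_mono h0 hg0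
    · have hgg' : g'' ∈ T.gens (T.chartAt (σ (Fin.last (m + 1)))) (T.tail σ 0) \ T.gens _ (σ 0) :=
        Finset.mem_sdiff.2 ⟨hg'', hg0⟩
      rw [hg, Finset.mem_singleton] at hgg hgg'
      rwa [hgg', ← hgg]

/-- Faces of the finite simplex `Δ` have no divisorial directions, so the coboundary that separates
two representatives of the eigenwave vanishes on them. -/
lemma eigenwave_val {y : T.Cell → X} {f}
    (hf : T.IsDivCochain f)
    (hψ : ∀ E F (h : E < F) a (ha : F.1 ⊆ T.U a), ψ.val E F h a ha =
      (T.pt a (y F) - T.pt a (y E)) + (f F a ha - f E a (Set.Subset.trans h.le ha)))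
    {E F : T.Cell} (h : E < F) (hF : F ≤ Δ.cell) {a : Fin T.numCharts} (ha : F.1 ⊆ T.U a) :
    ψ.val E F h a ha = T.pt a (y F) - T.pt a (y E) := by
  have key : ∀ G : T.Cell, G ≤ Δ.cell → ∀ ha : G.1 ⊆ T.U a, f G a ha = 0 := by
    intro G hG ha
    have := hf.1 G a ha
    rw [divSpace, T.dirs_eq_empty Δ.isFinite hG a ha] at this
    simpa using this
  rw [hψ, key F hF, key E (h.le.trans hF), sub_self, add_zero]

/-- The contribution of a facet of `τ₀ ≤ Δ` is given by a barycentric coordinate. -/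
lemma capTerm_twist_of_le {y : T.Cell → X} (hy : ∀ F, y F ∈ F.1)
    (hψ : ∀ E F (h : E < F), F ≤ Δ.cell → ∀ a (ha : F.1 ⊆ T.U a),
      ψ.val E F h a ha = T.pt a (y F) - T.pt a (y E))
    {hm : (m + 1) + r = k + l} {hm' : m + (r + 1) = k + l} {σ : T.BarSimplex (m + 1)}
    (hτ : (T.tail σ 0 ≤ Δ.cell ∧ T.cellDim (T.tail σ 0) = r + 1) ∧
      (Δ.cell ≤ T.tail σ (Fin.last m) ∧
        T.cellDim (T.tail σ (Fin.last m)) = T.cellDim Δ.cell + l))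
    {v : X} (hv : v ∈ T.verts (T.tail σ 0)) (hσ : T.verts (σ 0) = (T.verts (T.tail σ 0)).erase v)
    {t : X → ℝ} (ht : ∑ w ∈ T.verts (T.tail σ 0), t w = 1)
    (hyt : T.pt (T.chartAt (σ (Fin.last (m + 1)))) (y (T.tail σ 0)) =
      ∑ w ∈ T.verts (T.tail σ 0), t w • T.pt _ w) :
    (T.capTerm ψ (T.twist Δ c r (m + 1) hm) σ).1 =
      t v • (T.twist Δ c (r + 1) m hm' (T.tail σ)).1 := by
  obtain ⟨⟨h0, hr⟩, h1, hl⟩ := id hτ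
  have ha := T.subset_chartAt (σ (Fin.last (m + 1)))
  have h01 : σ 0 < T.tail σ 0 := σ.strictMono (Fin.succ_pos 0)
  have h1m : T.tail σ 0 ≤ σ (Fin.last (m + 1)) := σ.monotone (Fin.le_last _)
  have hU := Set.Subset.trans h1m ha
  have hU0 : (σ 0).1 ⊆ _ := Set.Subset.trans h01.le hU
  have hdE := T.dirs_eq_empty Δ.isFinite (h01.le.trans h0) _ hU0
  have hdF := T.dirs_eq_empty Δ.isFinite h0 _ hU
  have hg := gens_sdiff_of_verts hv hσ hdF hdE
  have hdim : T.cellDim (σ 0) = r := by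
    have h2 := cellDim_add_one hU
    have h3 := cellDim_add_one hU0
    rw [gens_eq_of_dirs hdF, Finset.card_disjSum, Finset.card_empty, hr] at h2
    rw [gens_eq_of_dirs hdE, Finset.card_disjSum, Finset.card_empty, hσ,
      Finset.card_erase_of_mem hv] at h3
    omega
  have hσ' : (σ 0 ≤ Δ.cell ∧ T.cellDim (σ 0) = r) ∧ (Δ.cell ≤ σ (Fin.last (m + 1)) ∧
      T.cellDim (σ (Fin.last (m + 1))) = T.cellDim Δ.cell + l) :=
    ⟨⟨h01.le.trans h0, hdim⟩, h1, hl⟩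
  obtain ⟨s, hs, hys⟩ := exists_barycentric_coords hU0 hdE (hy (σ 0))
    (Δ.isFinite _ _ (h01.le.trans h0 (hy _)) (hU0 (hy _)))
  obtain ⟨η, hη, hvol⟩ := ι_mul_simplexVol h01.le hg
  have hsign := dualSign_tail Δ h0 h1 hg hη hvol
  -- The sign `η` enters once through the volume element and once through the sign of the flag.
  have hηη : η * η = 1 := by rcases hη with rfl | rfl <;> norm_num
  have hid : killDirs (∅ : Finset (Fin (T.N (T.chartAt (σ (Fin.last (m + 1))))))) =
      LinearMap.id := LinearMap.ext killDirs_empty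
  have hface : ExteriorAlgebra.ι ℝ (ψ.val (σ 0) (T.tail σ 0) h01 _ hU) * T.faceVol Δ σ =
      (t v * η) • T.faceVol Δ (T.tail σ) := by
    have hrel := simplexVol_mul_relVol (a := T.chartAt (σ (Fin.last (m + 1))))
      (T.verts_mono h01.le (T.base_mem (σ 0))) (T.base_mem (T.tail σ 0)) Δ.cell
      (σ (Fin.last (m + 1)))
    rw [hψ _ _ _ h0, faceVol, ← mul_assoc, ι_sub_mul_simplexVol hv hσ ht hyt hs hys, hvol,
      smul_smul, smul_mul_assoc, hrel]
    rfl
  refine (capTerm_val _ _ hdE h01 hU).trans ?_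
  rw [hdF, hid, ExteriorAlgebra.map_id, twist_val hσ', twist_val hτ,
    AlgHom.id_apply, mul_smul_comm, hface, hsign, smul_smul]
  have hscal : ∀ ρ d : ℝ, ρ * (η * d) * (t v * η) = t v * (ρ * d) := fun ρ d => by
    linear_combination (ρ * d * t v) * hηη
  exact (smul_smul _ _ (T.faceVol Δ (T.tail σ))).trans
    (congrArg (· • T.faceVol Δ (T.tail σ)) (hscal _ _))

end Cap

/-- The cap product with the eigenwave maps `c[-r]` to `c[-r-1]`. -/
theorem cap_twist {b : T.Cell → X} {ψ : T.WaveCochain}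
    (hψ : T.IsEigenwave b ψ) {k l : ℕ} {Δ : T.OrientedSimplex k} {c : T.propellers Δ.cell l}
    {r m : ℕ} {hm : (m + 1) + r = k + l} {hm' : m + (r + 1) = k + l} :
    T.cap ψ (T.twist Δ c r (m + 1) hm) = T.twist Δ c (r + 1) m hm' := by
  obtain ⟨y, hy, f, hf, hψ⟩ := hψ
  have hyF : ∀ F, y F ∈ F.1 := fun F => (hy F).1
  have hψ' : ∀ E F (h : E < F), F ≤ Δ.cell → ∀ a (ha : F.1 ⊆ T.U a),
      ψ.val E F h a ha = T.pt a (y F) - T.pt a (y E) :=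
    fun E F h hF a ha => eigenwave_val hf hψ h hF ha
  funext τ
  rw [cap, Finset.sum_apply]
  -- Flags outside the support of `c[-r-1]` are treated first. For `r = k` these are all flags,
  -- since `Δ` has no face of dimension `k + 1`.
  by_cases hτ : (τ 0 ≤ Δ.cell ∧ T.cellDim (τ 0) = r + 1) ∧ (Δ.cell ≤ τ (Fin.last m) ∧
      T.cellDim (τ (Fin.last m)) = T.cellDim Δ.cell + l)
  swap
  · rw [twist, dif_neg hτ]
    refine Finset.sum_eq_zero fun σ _ => ?_
    by_cases hσ : τ = T.tail σ
    swap
    · exact Pi.single_eq_of_ne hσ _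
    subst hσ
    rw [Pi.single_eq_same]
    by_cases h0 : T.tail σ 0 ≤ Δ.cell
    · apply capTerm_eq_zero
      refine dif_neg fun h => hτ ⟨⟨h0, cellDim_tail (hm := hm) h⟩, h.2⟩
    · exact capTerm_twist_eq_zero h0
  obtain ⟨⟨h0, hr⟩, h1, hl⟩ := id hτ
  have ha := T.subset_chartAt (τ (Fin.last m))
  have hU : (τ 0).1 ⊆ _ := Set.Subset.trans (τ.monotone (Fin.zero_le _)) ha
  have hd := T.dirs_eq_empty Δ.isFinite h0 _ hU
  obtain ⟨t, ht, hyt⟩ := exists_barycentric_coords hU hd (hyF (τ 0))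
    (Δ.isFinite _ _ (h0 (hyF _)) (hU (hyF _)))
  -- At least two vertices are present, so each of them can be omitted to give a facet.
  have hcard : (T.verts (τ 0)).card = r + 2 := by
    have := cellDim_add_one hU
    rw [gens_eq_of_dirs hd, Finset.card_disjSum, Finset.card_empty, hr] at this
    omega
  have hex : ∀ v ∈ T.verts (τ 0), ∃ σ : T.BarSimplex (m + 1),
      T.tail σ = τ ∧ T.verts (σ 0) = (T.verts (τ 0)).erase v := by
    intro v hv
    obtain ⟨E, hE, hEv⟩ := exists_facet hv (Finset.card_pos.1 (by
      rw [Finset.card_erase_of_mem hv]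
      omega))
    obtain ⟨σ, hσ, rfl⟩ := exists_flag_cons hE
    exact ⟨σ, hσ, hEv⟩
  have : Nonempty (T.BarSimplex (m + 1)) := ⟨(hex _ (T.base_mem (τ 0))).choose⟩
  choose! e he hev using hex
  apply Subtype.ext
  rw [Submodule.coe_sum]
  -- The flags over `τ` that contribute are indexed by the vertex of `τ₀` that their first cell
  -- omits.
  have hsum : ∑ v ∈ T.verts (τ 0), t v • (T.twist Δ c (r + 1) m hm' τ).1 =
      ∑ σ : T.BarSimplex (m + 1), ((Pi.single (T.tail σ)
        (T.capTerm ψ (T.twist Δ c r (m + 1) hm) σ) : T.Chain (l + r + 1) m) τ).1 := by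
    refine Finset.sum_of_injOn e ?_ (fun _ _ => Finset.mem_coe.2 (Finset.mem_univ _)) ?_ ?_
    · intro v hv w hw hvw
      have h := hev v hv
      rw [hvw, hev w hw] at h
      exact (Finset.erase_injOn _ hw hv h).symm
    · intro σ _ hσe
      by_cases hσ : τ = T.tail σ
      swap
      · rw [Pi.single_eq_of_ne hσ]
        rfl
      subst hσ
      rw [Pi.single_eq_same]
      by_cases hσ' : (σ 0 ≤ Δ.cell ∧ T.cellDim (σ 0) = r) ∧ (Δ.cell ≤ σ (Fin.last (m + 1)) ∧
        T.cellDim (σ (Fin.last (m + 1))) = T.cellDim Δ.cell + l)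
      swap
      · rw [capTerm_eq_zero (dif_neg hσ')]
        rfl
      -- A flag in the support adds one generator in its first step, and this is a vertex `v`
      -- because `τ₀` is finite. Its first cell then has the same generators as the facet opposite
      -- to `v`, so the flag is `e v`.
      exfalso
      have h01 : σ 0 < T.tail σ 0 := σ.strictMono (Fin.succ_pos 0)
      have hd0 := T.dirs_eq_empty Δ.isFinite hσ'.1.1 _ (Set.Subset.trans h01.le hU)
      obtain ⟨g, hg⟩ := exists_gens_sdiff hU h01.le (by rw [hr, hσ'.1.2])
      have hgm := Finset.mem_sdiff.1 (hg ▸ Finset.mem_singleton_self g)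
      rcases g with v | i
      swap
      · have := inr_mem_gens.1 hgm.1
        rw [hd] at this
        exact Finset.notMem_empty _ this
      have hv := inl_mem_gens.1 hgm.1
      refine hσe ⟨v, hv, flag_ext (he v hv) ?_⟩
      have hE : e v 0 < T.tail σ 0 := by
        have h : T.tail (e v) 0 = T.tail σ 0 := by rw [he v hv]
        rw [← h]
        exact (e v).strictMono (Fin.succ_pos 0)
      have hdE := T.dirs_eq_empty Δ.isFinite (hE.le.trans h0) _ (Set.Subset.trans hE.le hU)
      have hverts : T.verts (e v 0) = T.verts (σ 0) := by
        rw [hev v hv]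
        ext w
        have hw : Sum.inl w ∈ T.gens (T.chartAt (T.tail σ (Fin.last m))) (T.tail σ 0) \
            T.gens _ (σ 0) ↔ w = v := by rw [hg, Finset.mem_singleton, Sum.inl.injEq]
        rw [Finset.mem_sdiff, inl_mem_gens, inl_mem_gens] at hw
        have := @verts_mono _ _ T _ _ h01.le w
        rw [Finset.mem_erase]
        tauto
      have hgens : T.gens (T.chartAt (T.tail σ (Fin.last m))) (e v 0) = T.gens _ (σ 0) := by
        rw [gens_eq_of_dirs hdE, gens_eq_of_dirs hd0, hverts]
      exact le_antisymm (le_of_gens_subset hU hE.le h01.le hgens.le)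
        (le_of_gens_subset hU h01.le hE.le hgens.ge)
    · intro v hv
      have hσ := he v hv
      have hσv := hev v hv
      generalize e v = σ at hσ hσv
      subst hσ
      rw [Pi.single_eq_same]
      exact (capTerm_twist_of_le hyF hψ' hτ hv hσv ht hyt).symm
  rw [← hsum, ← Finset.sum_smul, ht, one_smul]

end UnimodularComplex

end Tropical11

end

theorem mainTheorem11 {X : Type*} [TopologicalSpace X]
    (T : Tropical11.UnimodularTropicalSpace X)
    (b : T.Cell → X) (hb : T.IsBarycenter b)
    (ψ : T.WaveCochain) (hψ : T.IsEigenwave b ψ)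
    {k l : ℕ} (Δ : T.OrientedSimplex k) (c : T.propellers Δ.cell l)
    (r m : ℕ) (hr : r ≤ k) (hm : (m + 1) + r = k + l) :
    T.cap ψ (T.twist Δ c r (m + 1) hm) =
      T.twist Δ c (r + 1) m ((Nat.succ_add_eq_add_succ m r).symm.trans hm) :=
  Tropical11.UnimodularComplex.cap_twist hψ
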